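/- **Setting.** Let $d_x\ge 1$, let $\|\cdot\|$ be a norm on $\mathbb{R}^{d_x}$, and fix $C>0$. Given covariates $x_1,\dots,x_n\in\mathbb{R}^{d_x}$ and treatments $d_1,\dots,d_n\in\{0,1\}$, the outcomes $y_i$ are independent with $y_i\sim N(f(x_i,d_i),\sigma^2(x_i,d_i))$, where $\sigma^2$ is known and $f$ is an unknown element of $$\mathcal F=\mathcal F_{\mathrm{Lip}}(C)=\{f:\ |f(x,d)-f(\tilde x,d)|\le C\|x-\tilde x\|\ \text{ for all }x,\tilde x,\ d\in\{0,1\}\}.$$ Let $P_f,E_f$ denote probability and expectation under $f$. The parameter is $Lf=\frac1n\sum_{i=1}^n[f(x_i,1)-f(x_i,0)]$. A linear estimator is $\hat L_k=\sum_i k_iy_i$ with $k\in\mathbb{R}^n$ (depending only on the $x_i,d_i$); its worst-case bias is $B(k)=\sup_{f\in\mathcal F}E_f(\hat L_k-Lf)\in[0,\infty]$ and its standard deviation is $s(k)=(\sum_ik_i^2\sigma^2(x_i,d_i))^{1/2}$. Let $z_p$ be the standard normal $p$-quantile and $\mathrm{cv}_\alpha(b)$ the $1-\alpha$ quantile of $|Z|$,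 $Z\sim N(b,1)$. The performance criteria are (infinite if $B(k)=\infty$): * worst-case MSE: $\sup_{f\in\mathcal F}E_f(\hat L_k-Lf)^2$; * length of the fixed-length confidence interval (FLCI): $2\,\mathrm{cv}_\alpha(B(k)/s(k))\,s(k)$; * worst-case $\beta$-quantile of excess length of the one-sided CI $[\hat c,\infty)$, $\hat c=\hat L_k-B(k)-z_{1-\alpha}s(k)$: the supremum over $g\in\mathcal F$ of the $\beta$-quantile of $Lg-\hat c$ under $P_g$. For each criterion, $R^*_{n,\mathrm{match}}$ is its value for the matching estimator with $M=1$, with weights $k_i=\frac1n(2d_i-1)(1+K_1(i))$, where $K_1(i)$ is the number of $j$ with $d_j\ne d_i$ for which $x_i$ is closest to $x_j$ among all $x_l$ with $d_l=d_i$; and $R^*_{n,\mathrm{opt}}$ is its infimum over all $k\in\mathbb{R}^n$. **Theorem.** Let $(X_i,D_i)$, $i\ge1$, be i.i.d. in $\mathbb{R}^{d_x}\times\{0,1\}$ with $0<P(D_i=1)<1$, such that $X_i$ has a bounded Lebesgue density conditional on $D_i=d$ for each $d\in\{0,1\}$. Suppose that the Gaussian model above holds conditional on $(x_i,d_i)=(X_i,D_i)$,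 $i\le n$, with $\sigma^2(x,d)$ bounded away from zero and infinity. Let $\mathcal X$ be a set with $X_i\in\mathcal X$ almost surely, and let $\underline G,\overline G$ be positive functions on $(0,\infty)$ such that, for all sufficiently small $a>0$, all $x\in\mathcal X$ and $d\in\{0,1\}$, $$\underline G(a)\le P(\|X_i-x\|\le a,\ D_i=d)\le\overline G(a),$$ and $$\lim_{t\downarrow0}\ \overline G(\underline G^{-1}(t))^2\big/[t/\log t^{-1}]^{2/d_x+1}=0,\qquad \underline G^{-1}(t)=\inf\{a>0:\underline G(a)\ge t\}.$$ Then $R^*_{n,\mathrm{match}}/R^*_{n,\mathrm{opt}}\to1$ almost surely as $n\to\infty$, where both quantities are computed conditional on $\{(X_i,D_i)\}_{i=1}^n$, for each of the following criteria: (i) worst-case MSE; (ii) FLCI length, for every $0<\alpha\le 1/2$; (iii) worst-case $\beta$-quantile of excess length of the one-sided CI, for all $0<\alpha\le\beta<1$. -/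

import Mathlib

open MeasureTheory ProbabilityTheory Filter Topology
open scoped ENNReal NNReal

namespace CATE

/-- The Lipschitz class `F_Lip(C)`. The treatment value `1` is `true`, the value `0` is `false`. -/
def FLip {E : Type*} [NormedAddCommGroup E] (C : ℝ) : Set (E → Bool → ℝ) :=
  {f | ∀ (d : Bool) (x x' : E), |f x d - f x' d| ≤ C * ‖x - x'‖}

/-- The conditional average treatment effect `Lf` at the covariate values `x`. -/
noncomputable def cate {E : Type*} {n : ℕ} (x : Fin n → E) (f : E → Bool → ℝ) : ℝ :=
  (1 / (n : ℝ)) * ∑ i, (f (x i) true - f (x i) false)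

/-- The law `P_f` of the outcomes `(y_1, …, y_n)` given covariates `x` and treatments `d`: the
`y_i` are independent and `y_i` is normal with mean `f(x_i, d_i)` and variance `σ²(x_i, d_i)`. -/
noncomputable def outcomeLaw {E : Type*} {n : ℕ} (σ2 : E → Bool → ℝ≥0) (x : Fin n → E)
    (d : Fin n → Bool) (f : E → Bool → ℝ) : Measure (Fin n → ℝ) :=
  Measure.pi fun i => gaussianReal (f (x i) (d i)) (σ2 (x i) (d i))

/-- The linear estimator with weights `k`. -/
noncomputable def linEst {n : ℕ} (k : Fin n → ℝ) (y : Fin n → ℝ) : ℝ := ∑ i, k i * y i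

/-- The number of times that unit `i` is matched when every unit is matched (with replacement)
to the `M` closest units with the opposite treatment. -/
noncomputable def matchCount {E : Type*} [NormedAddCommGroup E] {n : ℕ} (M : ℕ) (x : Fin n → E)
    (d : Fin n → Bool) (i : Fin n) : ℕ :=
  {j : Fin n | d j ≠ d i ∧ {l : Fin n | d l = d i ∧ ‖x l - x j‖ < ‖x i - x j‖}.ncard < M}.ncard

/-- The weights of the matching estimator with `M` matches. -/
noncomputable def matchWeight {E : Type*} [NormedAddCommGroup E] {n : ℕ} (M : ℕ) (x : Fin n → E)
    (d : Fin n → Bool) (i : Fin n) : ℝ :=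
  (1 / (n : ℝ)) * (if d i then 1 else -1) * (1 + (matchCount M x d i : ℝ) / (M : ℝ))

/-- The standard deviation of the linear estimator with weights `k`. -/
noncomputable def sd {E : Type*} {n : ℕ} (σ2 : E → Bool → ℝ≥0) (x : Fin n → E)
    (d : Fin n → Bool) (k : Fin n → ℝ) : ℝ :=
  Real.sqrt (∑ i, k i ^ 2 * (σ2 (x i) (d i) : ℝ))

/-- The worst-case bias `sup_f E_f(L̂_k - Lf)` over `F_Lip(C)`, which may be `+∞`. -/
noncomputable def maxBias {E : Type*} [NormedAddCommGroup E] {n : ℕ} (C : ℝ)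
    (σ2 : E → Bool → ℝ≥0) (x : Fin n → E) (d : Fin n → Bool) (k : Fin n → ℝ) : EReal :=
  ⨆ f ∈ FLip (E := E) C, ((∫ y, (linEst k y - cate x f) ∂(outcomeLaw σ2 x d f) : ℝ) : EReal)

/-- The worst-case mean squared error over `F_Lip(C)`. -/
noncomputable def worstMSE {E : Type*} [NormedAddCommGroup E] {n : ℕ} (C : ℝ)
    (σ2 : E → Bool → ℝ≥0) (x : Fin n → E) (d : Fin n → Bool) (k : Fin n → ℝ) : ℝ≥0∞ :=
  ⨆ f ∈ FLip (E := E) C,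
    ∫⁻ y, ENNReal.ofReal ((linEst k y - cate x f) ^ 2) ∂(outcomeLaw σ2 x d f)

/-- The `p`-quantile of a probability distribution on the real line. -/
noncomputable def quantile (ν : Measure ℝ) (p : ℝ) : ℝ :=
  sInf {c : ℝ | ENNReal.ofReal p ≤ ν (Set.Iic c)}

/-- The standard normal quantile `z_p`. -/
noncomputable def zq (p : ℝ) : ℝ := quantile (gaussianReal 0 1) p

/-- The critical value `cv_α(b)`: the `1 - α` quantile of `|Z|` for `Z ∼ N(b, 1)`. -/
noncomputable def cv (α b : ℝ) : ℝ :=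
  quantile ((gaussianReal b 1).map fun z => |z|) (1 - α)

open Classical in
/-- The length `2 cv_α(maxbias / sd) sd` of the fixed-length confidence interval around the
linear estimator with weights `k` (infinite when the worst-case bias is infinite). -/
noncomputable def flciLength {E : Type*} [NormedAddCommGroup E] {n : ℕ} (α C : ℝ)
    (σ2 : E → Bool → ℝ≥0) (x : Fin n → E) (d : Fin n → Bool) (k : Fin n → ℝ) : EReal :=
  if maxBias C σ2 x d k = ⊤ then ⊤
  else ((2 * cv α ((maxBias C σ2 x d k).toReal / sd σ2 x d k) * sd σ2 x d k : ℝ) : EReal)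

/-- The lower endpoint `ĉ = L̂_k - maxbias - z_{1-α} sd` of the one-sided confidence interval
`[ĉ, ∞)` based on the linear estimator with weights `k`. -/
noncomputable def lowerEndpoint {E : Type*} [NormedAddCommGroup E] {n : ℕ} (α C : ℝ)
    (σ2 : E → Bool → ℝ≥0) (x : Fin n → E) (d : Fin n → Bool) (k : Fin n → ℝ)
    (y : Fin n → ℝ) : EReal :=
  (linEst k y : EReal) - maxBias C σ2 x d k - ((zq (1 - α) * sd σ2 x d k : ℝ) : EReal)

/-- The worst-case `β`-quantile over `g ∈ F_Lip(C)` of the excess length `Lg - ĉ` of the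
one-sided confidence interval `[ĉ, ∞)` based on the linear estimator with weights `k`. -/
noncomputable def worstExcess {E : Type*} [NormedAddCommGroup E] {n : ℕ} (α β C : ℝ)
    (σ2 : E → Bool → ℝ≥0) (x : Fin n → E) (d : Fin n → Bool) (k : Fin n → ℝ) : EReal :=
  ⨆ g ∈ FLip (E := E) C,
    sInf {c : EReal | ENNReal.ofReal β ≤
      outcomeLaw σ2 x d g {y | (cate x g : EReal) - lowerEndpoint α C σ2 x d k y ≤ c}}

/-- `ν` has a bounded density with respect to `vol`. -/
def HasBoundedDensity {E : Type*} [MeasurableSpace E] (vol ν : Measure E) : Prop :=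
  ∃ g : E → ℝ≥0∞, Measurable g ∧ (∃ K : ℝ≥0, ∀ x, g x ≤ K) ∧ ν = vol.withDensity g

/-- The inverse `G⁻¹(t) = inf {a > 0 : G(a) ≥ t}`. If `G` is strictly increasing and
`t = G(a)` with `a > 0`, then it equals `a`. -/
noncomputable def genInv (G : ℝ → ℝ) (t : ℝ) : ℝ := sInf {a : ℝ | 0 < a ∧ t ≤ G a}

end CATE

/-! Test any weights against a Lipschitz function that vanishes at all observed pairs `(x i, d i)`:
up to sign, `C` times the distance to the sample points of the given arm (`leastFavorable`). All
outcomes then have mean zero, so the bias is `-Lf = matchBias`, whatever the weights. Matching with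
one neighbour imputes each missing outcome with error at most `C` times the same distance, so it
attains this bound and minimizes the worst-case bias (`matchBias_le_maxBias`, `maxBias_match`).
Every criterion is at least `matchBias ^ 2` or `2 * matchBias` for every `k`, and for matching it
exceeds this by at most the variance or a fixed multiple of the standard deviation. All three claims
thus reduce to `sd / matchBias → 0` almost surely (`BiasDominates`).

Rates: let `p` be the dimension, `t = 8 log n / n`, `a = Glow⁻¹(t)` and `G = Gup(a)`. Balls of
radius `a` about points of the closure of `S` have mass between `t` and `G` in each arm. Hence
eventually every unit finds a match within `a`, and a Chernoff bound caps all match counts by a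
multiple of `n G`; as the counts sum to `n`, the variance is `O(G)`. A bounded density keeps at
least half of the points `n ^ (-9/(8p))` away from all others, so the bias is at least of that
order; the exponent is a little beyond the natural `1/p` so that Markov bounds are summable along
powers of two. Overlap makes `G` of smaller order than `n ^ (-1/p - 1/2)`, which beats the squared
bias `n ^ (-9/(4p))` when `p > 5/2`; and since `G ≥ t`, overlap itself forces `p ≥ 3`. -/

namespace CATE

/-! ### Normal laws and quantiles -/

section Gaussian

variable {E : Type*} {n : ℕ}

instance (σ2 : E → Bool → ℝ≥0) (x : Fin n → E) (d : Fin n → Bool) (f : E → Bool → ℝ) :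
    IsProbabilityMeasure (outcomeLaw σ2 x d f) := by
  unfold outcomeLaw; infer_instance

@[fun_prop]
lemma measurable_linEst (k : Fin n → ℝ) : Measurable (linEst k) := by
  unfold linEst; fun_prop

lemma sd_nonneg (σ2 : E → Bool → ℝ≥0) (x : Fin n → E) (d : Fin n → Bool) (k : Fin n → ℝ) :
    0 ≤ sd σ2 x d k := Real.sqrt_nonneg _

lemma sd_sq (σ2 : E → Bool → ℝ≥0) (x : Fin n → E) (d : Fin n → Bool) (k : Fin n → ℝ) :
    sd σ2 x d k ^ 2 = ∑ i, k i ^ 2 * (σ2 (x i) (d i) : ℝ) :=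
  Real.sq_sqrt (Finset.sum_nonneg fun i _ => by positivity)

/-- A linear combination of the outcomes is normal. -/
lemma map_linEst (σ2 : E → Bool → ℝ≥0) (x : Fin n → E) (d : Fin n → Bool) (f : E → Bool → ℝ)
    (k : Fin n → ℝ) :
    (outcomeLaw σ2 x d f).map (linEst k) =
      (gaussianReal 0 1).map
        (fun z => (∑ i, k i * f (x i) (d i)) + sd σ2 x d k * z) := by
  set P := outcomeLaw σ2 x d f with hP
  have hlaw : ∀ i, P.map (fun y => y i) = gaussianReal (f (x i) (d i)) (σ2 (x i) (d i)) := fun i =>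
    (measurePreserving_eval (fun i => gaussianReal (f (x i) (d i)) (σ2 (x i) (d i))) i).map_eq
  have hg : ∀ i, HasGaussianLaw (fun y : Fin n → ℝ => y i) P := fun i =>
    HasLaw.hasGaussianLaw (μ := gaussianReal (f (x i) (d i)) (σ2 (x i) (d i)))
      ⟨(measurable_pi_apply i).aemeasurable, hlaw i⟩
  have hi0 : iIndepFun (fun (i : Fin n) (y : Fin n → ℝ) => y i) P :=
    iIndepFun_pi (X := fun _ => id) (fun _ => aemeasurable_id)
  have hi : iIndepFun (fun (i : Fin n) (y : Fin n → ℝ) => k i * y i) P :=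
    hi0.comp (fun i z => k i * z) (fun i => by fun_prop)
  have hgk : ∀ i, HasGaussianLaw (fun y : Fin n → ℝ => k i * y i) P := fun i => by
    simpa using (hg i).fun_smul (k i)
  have hs : HasGaussianLaw (linEst k) P := hi.hasGaussianLaw_fun_sum hgk
  rw [hs.map_eq_gaussianReal]
  have hmean : ∀ i, ∫ y, y i ∂P = f (x i) (d i) := fun i => by
    have := integral_map (μ := P) (φ := fun y => y i) (f := fun z : ℝ => z)
      (measurable_pi_apply i).aemeasurable (by fun_prop)
    rw [← this, hlaw i, integral_id_gaussianReal]
  have hvar : ∀ i, Var[fun y => y i; P] = σ2 (x i) (d i) := fun i => by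
    have := variance_map (μ := P) (X := id) (Y := fun y : Fin n → ℝ => y i)
      (by fun_prop) (measurable_pi_apply i).aemeasurable
    rw [hlaw i, variance_id_gaussianReal] at this
    exact this.symm
  have h1 : ∫ y, linEst k y ∂P = ∑ i, k i * f (x i) (d i) := by
    unfold linEst
    rw [integral_finsetSum _ fun i _ => (hgk i).integrable]
    exact Finset.sum_congr rfl fun i _ => by rw [integral_const_mul, hmean]
  have h2 : Var[linEst k; P] = sd σ2 x d k ^ 2 := by
    have : linEst k = ∑ i, fun y => k i * y i := by ext y; simp [linEst]
    rw [this, IndepFun.variance_sum (fun i _ => (hgk i).memLp_two)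
      (fun i _ j _ hij => hi.indepFun hij), sd_sq]
    exact Finset.sum_congr rfl fun i _ => by rw [variance_const_mul, hvar]
  rw [h1, h2]
  -- Scaling first and shifting afterwards also covers a zero standard deviation, where the law is a
  -- point mass.
  have h3 : (fun z => (∑ i, k i * f (x i) (d i)) + sd σ2 x d k * z) =
      (fun z => (∑ i, k i * f (x i) (d i)) + z) ∘ (fun z => sd σ2 x d k * z) := rfl
  rw [h3, ← Measure.map_map (by fun_prop) (by fun_prop), gaussianReal_map_const_mul,
    gaussianReal_map_const_add]
  congr 1
  · ring
  · ext; simp [Real.coe_toNNReal _ (sq_nonneg (sd σ2 x d k))]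

lemma integral_linEst_sub (σ2 : E → Bool → ℝ≥0) (x : Fin n → E) (d : Fin n → Bool)
    (f : E → Bool → ℝ) (k : Fin n → ℝ) (c : ℝ) :
    ∫ y, (linEst k y - c) ∂(outcomeLaw σ2 x d f) = (∑ i, k i * f (x i) (d i)) - c := by
  have h := integral_map (μ := outcomeLaw σ2 x d f) (φ := linEst k) (f := fun z : ℝ => z - c)
    (by fun_prop) (by fun_prop)
  have hid : Integrable (fun z : ℝ => z) (gaussianReal 0 1) :=
    (memLp_id_gaussianReal 1).integrable (by simp)
  rw [← h, map_linEst, integral_map (by fun_prop) (by fun_prop), integral_sub _ (by fun_prop),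
    integral_add (by fun_prop) (hid.const_mul _), integral_const_mul, integral_id_gaussianReal]
  · simp
  · exact (integrable_const _).add (hid.const_mul _)

lemma lintegral_sq_linEst_sub (σ2 : E → Bool → ℝ≥0) (x : Fin n → E) (d : Fin n → Bool)
    (f : E → Bool → ℝ) (k : Fin n → ℝ) (c : ℝ) :
    ∫⁻ y, ENNReal.ofReal ((linEst k y - c) ^ 2) ∂(outcomeLaw σ2 x d f) =
      ENNReal.ofReal (((∑ i, k i * f (x i) (d i)) - c) ^ 2 + sd σ2 x d k ^ 2) := by
  have h := lintegral_map (μ := outcomeLaw σ2 x d f) (g := linEst k)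
    (f := fun z : ℝ => ENNReal.ofReal ((z - c) ^ 2)) (by fun_prop) (by fun_prop)
  have hid : Integrable (fun z : ℝ => z) (gaussianReal 0 1) :=
    (memLp_id_gaussianReal 1).integrable (by simp)
  have hsq : Integrable (fun z : ℝ => z ^ 2) (gaussianReal 0 1) :=
    (memLp_id_gaussianReal 2).integrable_sq
  have hv : ∫ z, z ^ 2 ∂(gaussianReal 0 1) = 1 := by
    have := variance_of_integral_eq_zero (μ := gaussianReal 0 1) (X := fun z => z)
      (by fun_prop) (by simp)
    rw [variance_fun_id_gaussianReal] at this
    simpa using this.symm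
  rw [← h, map_linEst, lintegral_map (by fun_prop) (by fun_prop)]
  set m := ∑ i, k i * f (x i) (d i)
  set s := sd σ2 x d k
  have e : ∀ z : ℝ, (m + s * z - c) ^ 2 = (m - c) ^ 2 + (2 * (m - c) * s) * z + s ^ 2 * z ^ 2 :=
    fun z => by ring
  simp_rw [e]
  have hint : Integrable (fun z : ℝ => (m - c) ^ 2 + (2 * (m - c) * s) * z + s ^ 2 * z ^ 2)
    (gaussianReal 0 1) := ((integrable_const _).add (hid.const_mul _)).add (hsq.const_mul _)
  rw [← ofReal_integral_eq_lintegral_ofReal hint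
    (ae_of_all _ fun z => by simp only [Pi.zero_apply]; rw [← e]; positivity)]
  congr 1
  have hint' : Integrable (fun z : ℝ => (m - c) ^ 2 + (2 * (m - c) * s) * z) (gaussianReal 0 1) :=
    (integrable_const _).add (hid.const_mul _)
  rw [integral_add hint' (hsq.const_mul _),
    integral_add (integrable_const _) (hid.const_mul _), integral_const_mul, integral_const_mul,
    hv, integral_id_gaussianReal]
  simp

lemma gaussianReal_Iic_lt_Iic {m : ℝ} {v : ℝ≥0} (hv : v ≠ 0) {a b : ℝ} (hab : a < b) :
    gaussianReal m v (Set.Iic a) < gaussianReal m v (Set.Iic b) := by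
  have hd : Disjoint (Set.Iic a) (Set.Ioc a b) := Set.Iic_disjoint_Ioc le_rfl
  rw [← Set.Iic_union_Ioc_eq_Iic hab.le, measure_union hd measurableSet_Ioc]
  -- A null interval would also be Lebesgue null, by absolute continuity.
  refine ENNReal.lt_add_right (measure_ne_top _ _) fun h0 => ?_
  have := gaussianReal_absolutelyContinuous' m hv h0
  simp at this
  linarith

lemma gaussianReal_Iic_mean (m : ℝ) : gaussianReal m 1 (Set.Iic m) = 1 / 2 := by
  have : NullSingletonClass (gaussianReal m 1) := nullSingletonClass_gaussianReal one_ne_zero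
  have h1 : gaussianReal m 1 (Set.Ici m) = gaussianReal m 1 (Set.Iic m) := by
    have := gaussianReal_map_const_sub (μ := m) (v := 1) (2 * m)
    have e : 2 * m - m = m := by ring
    rw [e] at this
    conv_lhs => rw [← this]
    rw [Measure.map_apply (by fun_prop) measurableSet_Ici]
    congr 1; ext z; simp; constructor <;> intro h <;> linarith
  have h2 : gaussianReal m 1 (Set.Iic m) + gaussianReal m 1 (Set.Ioi m) = 1 := by
    rw [← measure_union (Set.Iic_disjoint_Ioi le_rfl) measurableSet_Ioi, Set.Iic_union_Ioi,
      measure_univ]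
  rw [measure_congr Ioi_ae_eq_Ici, h1, ← two_mul] at h2
  rw [ENNReal.eq_div_iff (by simp) (by simp), h2]

/-- Lower bound for the mass below a quantile. -/
lemma le_measure_Iic_quantile {ν : Measure ℝ} [IsProbabilityMeasure ν] {p : ℝ} (hp0 : 0 < p)
    (hp1 : p < 1) : ENNReal.ofReal p ≤ ν (Set.Iic (quantile ν p)) := by
  set A := {c : ℝ | ENNReal.ofReal p ≤ ν (Set.Iic c)} with hA
  -- The real infimum of the empty set is `0`, so the quantile is meaningful only because the mass
  -- of `Iic c` tends to `1 > p`.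
  have hne : A.Nonempty := by
    have := tendsto_measure_Iic_atTop ν
    rw [measure_univ] at this
    have h := (this.eventually (lt_mem_nhds (a := ENNReal.ofReal p) (by simpa using hp1))).exists
    exact ⟨h.choose, h.choose_spec.le⟩
  have hbdd : BddBelow A := by
    have hanti : Antitone fun m : ℕ => Set.Iic (-(m : ℝ)) := fun a b hab =>
      Set.Iic_subset_Iic.2 (by simpa using hab)
    have hI : ⋂ m : ℕ, Set.Iic (-(m : ℝ)) = ∅ := by
      refine Set.eq_empty_of_forall_notMem fun z hz => ?_
      obtain ⟨m, hm⟩ := exists_nat_gt (-z)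
      have := Set.mem_iInter.1 hz m
      simp at this
      linarith
    have := tendsto_measure_iInter_atTop (μ := ν)
      (fun m : ℕ => (measurableSet_Iic (a := -(m : ℝ))).nullMeasurableSet) hanti
      ⟨0, measure_ne_top _ _⟩
    rw [hI, measure_empty] at this
    obtain ⟨m, hb⟩ :=
      (this.eventually (gt_mem_nhds (a := ENNReal.ofReal p) (by simpa using hp0))).exists
    refine ⟨-(m : ℝ), fun c hc => le_of_not_gt fun hcb => ?_⟩
    exact absurd (hc.trans (measure_mono (Set.Iic_subset_Iic.2 hcb.le))) (not_le.2 hb)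
  -- Right continuity: `Iic` at the quantile is a decreasing intersection of half-lines, each of
  -- mass at least `p`.
  have hanti : Antitone fun m : ℕ => Set.Iic (quantile ν p + 1 / ((m : ℝ) + 1)) := fun a b hab =>
    Set.Iic_subset_Iic.2 (by gcongr)
  have hI : Set.Iic (quantile ν p) = ⋂ m : ℕ, Set.Iic (quantile ν p + 1 / ((m : ℝ) + 1)) := by
    ext z
    simp only [Set.mem_Iic, Set.mem_iInter]
    refine ⟨fun h m => h.trans (by simp; positivity), fun h => ?_⟩
    refine ge_of_tendsto' (x := atTop) ?_ h
    simpa using tendsto_const_nhds.add (tendsto_one_div_add_atTop_nhds_zero_nat (𝕜 := ℝ))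
  rw [hI, hanti.measure_iInter (fun _ => measurableSet_Iic.nullMeasurableSet)
    ⟨0, measure_ne_top _ _⟩]
  refine le_iInf fun m => ?_
  obtain ⟨c, hc, hlt⟩ := exists_lt_of_csInf_lt hne
    (show quantile ν p < quantile ν p + 1 / ((m : ℝ) + 1) by simp; positivity)
  exact le_trans hc (measure_mono (Set.Iic_subset_Iic.2 hlt.le))

/-- Supplies a constant, independent of the sample, that turns the quantiles of the matching
criteria into multiples of the standard deviation. -/
lemma exists_le_gaussianReal_abs_le {p : ℝ} (hp1 : p < 1) :
    ∃ q : ℝ, 0 ≤ q ∧ ENNReal.ofReal p ≤ gaussianReal 0 1 {z | |z| ≤ q} := by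
  have hmono : Monotone fun m : ℕ => {z : ℝ | |z| ≤ m} := fun a b hab z hz =>
    le_trans (Set.mem_ofPred_eq ▸ hz) (by exact_mod_cast hab)
  have hU : ⋃ m : ℕ, {z : ℝ | |z| ≤ m} = Set.univ :=
    Set.eq_univ_of_forall fun z => Set.mem_iUnion.2 (exists_nat_ge |z|)
  have h := tendsto_measure_iUnion_atTop (μ := gaussianReal 0 1) hmono
  rw [hU, measure_univ] at h
  obtain ⟨m, hm⟩ := (h.eventually (lt_mem_nhds (a := ENNReal.ofReal p) (by simpa using hp1))).exists
  exact ⟨m, by positivity, hm.le⟩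

end Gaussian

/-! ### Worst-case bias and criteria for a fixed sample -/

section Deterministic

variable {E : Type*} [NormedAddCommGroup E] {n : ℕ}

/-- The worst-case bias of the matching estimator with a single match. -/
noncomputable def matchBias (C : ℝ) (x : Fin n → E) (d : Fin n → Bool) : ℝ :=
  (1 / (n : ℝ)) * ∑ j, C * Metric.infDist (x j) (x '' {l | d l ≠ d j})

/-- A function in the Lipschitz class that vanishes at the sample points and maximizes the bias. -/
noncomputable def leastFavorable (C : ℝ) (x : Fin n → E) (d : Fin n → Bool) : E → Bool → ℝ :=
  fun z b => (if b then -1 else 1) * (C * Metric.infDist z (x '' {l | d l = b}))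

lemma matchBias_nonneg {C : ℝ} (hC : 0 ≤ C) (x : Fin n → E) (d : Fin n → Bool) :
    0 ≤ matchBias C x d :=
  mul_nonneg (by positivity)
    (Finset.sum_nonneg fun _ _ => mul_nonneg hC Metric.infDist_nonneg)

lemma neg_mem_FLip {C : ℝ} {f : E → Bool → ℝ} (hf : f ∈ FLip (E := E) C) :
    -f ∈ FLip (E := E) C := fun d z z' => by
  have := hf d z z'
  simp only [Pi.neg_apply]
  rwa [neg_sub_neg, abs_sub_comm]

lemma leastFavorable_mem {C : ℝ} (hC : 0 ≤ C) (x : Fin n → E) (d : Fin n → Bool) :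
    leastFavorable C x d ∈ FLip (E := E) C := fun b z z' => by
  have h := (Metric.lipschitz_infDist_pt (x '' {l | d l = b})).dist_le_mul z z'
  rw [Real.dist_eq, dist_eq_norm, NNReal.coe_one, one_mul] at h
  simp only [leastFavorable]
  rw [← mul_sub, ← mul_sub, abs_mul, abs_mul, abs_of_nonneg hC]
  have : |(if b then (-1 : ℝ) else 1)| = 1 := by split_ifs <;> simp
  rw [this, one_mul]
  gcongr

lemma leastFavorable_sample (C : ℝ) (x : Fin n → E) (d : Fin n → Bool) (i : Fin n) :
    leastFavorable C x d (x i) (d i) = 0 := by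
  rw [leastFavorable, Metric.infDist_zero_of_mem
    (Set.mem_image_of_mem x (show i ∈ {l | d l = d i} from rfl))]
  simp

/-- The own arm of unit `j` contributes zero and the opposite arm contributes the distance; the sign
attached to each arm makes both treatment cases count negatively. -/
lemma cate_leastFavorable (C : ℝ) (x : Fin n → E) (d : Fin n → Bool) :
    cate x (leastFavorable C x d) = -matchBias C x d := by
  unfold cate matchBias
  rw [← mul_neg, ← Finset.sum_neg_distrib]
  congr 1
  refine Finset.sum_congr rfl fun j _ => ?_
  have h := leastFavorable_sample C x d j
  cases hj : d j
  · rw [hj] at h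
    rw [h]
    simp [leastFavorable]
  · rw [hj] at h
    rw [h]
    simp [leastFavorable]

lemma cate_neg {E : Type*} (x : Fin n → E) (f : E → Bool → ℝ) : cate x (-f) = -cate x f := by
  simp only [cate, Pi.neg_apply]
  rw [← mul_neg, ← Finset.sum_neg_distrib]
  congr 1
  exact Finset.sum_congr rfl fun _ _ => by ring

lemma sum_mul_leastFavorable (C : ℝ) (x : Fin n → E) (d : Fin n → Bool) (k : Fin n → ℝ) :
    ∑ i, k i * leastFavorable C x d (x i) (d i) = 0 :=
  Finset.sum_eq_zero fun i _ => by rw [leastFavorable_sample, mul_zero]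

lemma bias_le_maxBias {C : ℝ} (σ2 : E → Bool → ℝ≥0) (x : Fin n → E) (d : Fin n → Bool)
    (k : Fin n → ℝ) {f : E → Bool → ℝ} (hf : f ∈ FLip (E := E) C) :
    (((∑ i, k i * f (x i) (d i)) - cate x f : ℝ) : EReal) ≤ maxBias C σ2 x d k := by
  rw [← integral_linEst_sub σ2]
  exact le_iSup₂ (f := fun (f : E → Bool → ℝ) (_ : f ∈ FLip (E := E) C) =>
    ((∫ y, (linEst k y - cate x f) ∂(outcomeLaw σ2 x d f) : ℝ) : EReal)) f hf

/-- Under the least favorable function every linear estimator has mean zero, so its bias is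
independent of the weights. -/
lemma matchBias_le_maxBias {C : ℝ} (hC : 0 ≤ C) (σ2 : E → Bool → ℝ≥0) (x : Fin n → E)
    (d : Fin n → Bool) (k : Fin n → ℝ) :
    (matchBias C x d : EReal) ≤ maxBias C σ2 x d k := by
  have := bias_le_maxBias σ2 x d k (leastFavorable_mem hC x d)
  rwa [sum_mul_leastFavorable, cate_leastFavorable, zero_sub, neg_neg] at this

lemma matchBias_le_toReal_maxBias {C : ℝ} (hC : 0 ≤ C) (σ2 : E → Bool → ℝ≥0) (x : Fin n → E)
    (d : Fin n → Bool) (k : Fin n → ℝ) (h : maxBias C σ2 x d k ≠ ⊤) :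
    matchBias C x d ≤ (maxBias C σ2 x d k).toReal ∧
      ((maxBias C σ2 x d k).toReal : EReal) = maxBias C σ2 x d k := by
  have h1 := matchBias_le_maxBias hC σ2 x d k
  have h2 : maxBias C σ2 x d k ≠ ⊥ := fun h0 => by
    rw [h0] at h1
    exact absurd h1 (not_le.2 (EReal.bot_lt_coe _))
  have h3 := EReal.coe_toReal h h2
  refine ⟨?_, h3⟩
  rw [← h3] at h1
  exact_mod_cast h1

/-- An estimator with zero variance has infinite worst-case bias. -/
lemma sd_pos_of_maxBias_ne_top {C : ℝ} (hC : 0 ≤ C) {σ2 : E → Bool → ℝ≥0}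
    (hσ : ∀ z b, 0 < σ2 z b) (hn : 0 < n) (x : Fin n → E)
    (d : Fin n → Bool) (k : Fin n → ℝ) (h : maxBias C σ2 x d k ≠ ⊤) : 0 < sd σ2 x d k := by
  refine (sd_nonneg σ2 x d k).lt_of_ne fun h0 => h ?_
  have hk : ∀ i, k i = 0 := by
    have h1 := sd_sq σ2 x d k
    rw [← h0] at h1
    have h2 := (Finset.sum_eq_zero_iff_of_nonneg fun i _ => by positivity).1
      (h1.symm.trans (by norm_num))
    intro i
    have := h2 i (Finset.mem_univ i)
    have h3 : (σ2 (x i) (d i) : ℝ) ≠ 0 := by exact_mod_cast (hσ _ _).ne'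
    simpa [h3] using this
  rw [EReal.eq_top_iff_forall_lt]
  intro t
  -- Constant on each arm, hence in every Lipschitz class. The estimator with zero weights misses
  -- its effect `-(t + 1)` entirely.
  let f : E → Bool → ℝ := fun _ b => if b then -(t + 1) else 0
  have hf : f ∈ FLip (E := E) C := fun b z z' => by
    simp only [f, sub_self, abs_zero]; positivity
  refine lt_of_lt_of_le ?_ (bias_le_maxBias σ2 x d k hf)
  have hn' : (n : ℝ) ≠ 0 := by positivity
  have : (∑ i, k i * f (x i) (d i)) - cate x f = t + 1 := by
    simp [hk, cate, f]
    field_simp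
    ring
  rw [this]
  exact_mod_cast lt_add_one t

section Match

variable {x : Fin n → E} {d : Fin n → Bool}

/-- Without ties, matching with a single match is given by a nearest-neighbour map. -/
lemma exists_nearest (hopp : ∀ j, ∃ l, d l ≠ d j)
    (htie : ∀ i l j, i ≠ l → d j ≠ d i → ‖x l - x j‖ ≠ ‖x i - x j‖) :
    ∃ m : Fin n → Fin n, (∀ j, d (m j) ≠ d j) ∧
      (∀ j l, d l ≠ d j → ‖x (m j) - x j‖ ≤ ‖x l - x j‖) ∧
      ∀ i, matchCount 1 x d i = (Finset.univ.filter fun j => m j = i).card := by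
  have hex : ∀ j, ∃ m, d m ≠ d j ∧ ∀ l, d l ≠ d j → ‖x m - x j‖ ≤ ‖x l - x j‖ := fun j => by
    obtain ⟨l, hl⟩ := hopp j
    obtain ⟨m, hm, hmin⟩ := Finset.exists_min_image (Finset.univ.filter fun l => d l ≠ d j)
      (fun l => ‖x l - x j‖) ⟨l, by simpa using hl⟩
    exact ⟨m, by simpa using hm, fun l hl => hmin l (by simpa using hl)⟩
  choose m hm hmin using hex
  refine ⟨m, hm, hmin, fun i => ?_⟩
  rw [matchCount, ← Set.ncard_coe_finset]
  congr 1
  ext j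
  simp only [Finset.coe_filter, Finset.mem_univ, true_and, Set.mem_ofPred_eq]
  rw [Nat.lt_one_iff, Set.ncard_eq_zero (Set.toFinite _), Set.eq_empty_iff_forall_notMem]
  simp only [Set.mem_ofPred_eq, not_and, not_lt]
  constructor
  · rintro ⟨hji, hmini⟩
    by_contra hne
    have hdm : d (m j) = d i := by
      have := hm j
      revert this hji
      cases d j <;> cases d i <;> cases d (m j) <;> simp
    -- Otherwise `i` and `m j` would be two distinct nearest units of the same arm.
    exact htie i (m j) j (Ne.symm hne) hji (le_antisymm (hmin j i hji.symm) (hmini _ hdm))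
  · rintro rfl
    exact ⟨(hm j).symm, fun l hl => hmin j l (hl ▸ hm j)⟩

/-- The counts are the fibre sizes of the nearest-neighbour map, which is defined on all `n` units.
-/
lemma sum_matchCount (hopp : ∀ j, ∃ l, d l ≠ d j)
    (htie : ∀ i l j, i ≠ l → d j ≠ d i → ‖x l - x j‖ ≠ ‖x i - x j‖) :
    ∑ i, matchCount 1 x d i = n := by
  obtain ⟨m, -, -, hc⟩ := exists_nearest hopp htie
  simp_rw [hc]
  rw [← Finset.card_eq_sum_card_fiberwise (fun _ _ => Finset.mem_univ _)]
  simp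

/-- For each unit the own observed mean cancels; what remains is the difference of `f` between the
unit and its match within the arm of the match, controlled by the Lipschitz condition. -/
lemma abs_bias_match_le {C : ℝ} (hC : 0 ≤ C) (hopp : ∀ j, ∃ l, d l ≠ d j)
    (htie : ∀ i l j, i ≠ l → d j ≠ d i → ‖x l - x j‖ ≠ ‖x i - x j‖)
    {f : E → Bool → ℝ} (hf : f ∈ FLip (E := E) C) :
    |(∑ i, matchWeight 1 x d i * f (x i) (d i)) - cate x f| ≤ matchBias C x d := by
  obtain ⟨m, hm, hmin, hc⟩ := exists_nearest hopp htie
  let s : Fin n → ℝ := fun i => if d i then 1 else -1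
  -- Regroup by the matched units: counting how often `i` is used is summing over the fibre of `m`
  -- above `i`.
  have h1 : ∑ i, s i * (matchCount 1 x d i : ℝ) * f (x i) (d i) =
      ∑ j, s (m j) * f (x (m j)) (d (m j)) := by
    have := Finset.sum_fiberwise' (Finset.univ : Finset (Fin n)) m
      (fun i => s i * f (x i) (d i))
    rw [← this]
    refine Finset.sum_congr rfl fun i _ => ?_
    rw [Finset.sum_const, hc, nsmul_eq_mul]
    ring
  have h2 : (∑ i, matchWeight 1 x d i * f (x i) (d i)) - cate x f =
      (1 / (n : ℝ)) * ∑ j, (s (m j) * f (x (m j)) (d (m j)) + s j * f (x j) (d j) -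
        (f (x j) true - f (x j) false)) := by
    rw [Finset.sum_sub_distrib, Finset.sum_add_distrib, ← h1, ← Finset.sum_add_distrib, mul_sub,
      Finset.mul_sum]
    congr 1
    refine Finset.sum_congr rfl fun i _ => ?_
    simp only [matchWeight, s]
    simp only [Nat.cast_one, div_one]
    ring
  rw [h2, abs_mul, abs_of_nonneg (by positivity : (0 : ℝ) ≤ 1 / n)]
  unfold matchBias
  gcongr
  refine (Finset.abs_sum_le_sum_abs _ _).trans (Finset.sum_le_sum fun j _ => ?_)
  have h3 : |s (m j) * f (x (m j)) (d (m j)) + s j * f (x j) (d j) -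
        (f (x j) true - f (x j) false)| = |f (x (m j)) (d (m j)) - f (x j) (d (m j))| := by
    have := hm j
    simp only [s]
    revert this
    cases d j <;> cases d (m j) <;> simp
    · ring_nf
    · rw [← abs_neg]; ring_nf
  rw [h3]
  refine (hf _ _ _).trans ?_
  gcongr
  obtain ⟨l, hl⟩ := hopp j
  refine (Metric.le_infDist (Set.Nonempty.image x ⟨l, hl⟩)).2 ?_
  rintro _ ⟨l', hl', rfl⟩
  rw [dist_comm, dist_eq_norm]
  exact hmin j l' hl'

lemma maxBias_match {C : ℝ} (hC : 0 ≤ C) (σ2 : E → Bool → ℝ≥0) (hopp : ∀ j, ∃ l, d l ≠ d j)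
    (htie : ∀ i l j, i ≠ l → d j ≠ d i → ‖x l - x j‖ ≠ ‖x i - x j‖) :
    maxBias C σ2 x d (matchWeight 1 x d) = (matchBias C x d : EReal) := by
  refine le_antisymm (iSup₂_le fun f hf => ?_) (matchBias_le_maxBias hC σ2 x d _)
  rw [integral_linEst_sub]
  exact_mod_cast (le_abs_self _).trans (abs_bias_match_le hC hopp htie hf)

/-- In each squared weight one factor `1 + matchCount` is bounded by `κ` and the other is summed
exactly, to `2 * n`. The variance is thus linear in the largest count instead of quadratic. -/
lemma sd_sq_match_le {σ2 : E → Bool → ℝ≥0} {hi : ℝ≥0} (hσ : ∀ z b, σ2 z b ≤ hi)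
    (hopp : ∀ j, ∃ l, d l ≠ d j)
    (htie : ∀ i l j, i ≠ l → d j ≠ d i → ‖x l - x j‖ ≠ ‖x i - x j‖) {κ : ℝ}
    (hκ : ∀ i, 1 + (matchCount 1 x d i : ℝ) ≤ κ) :
    sd σ2 x d (matchWeight 1 x d) ^ 2 ≤ 2 * hi * κ / n := by
  rcases Nat.eq_zero_or_pos n with rfl | hn
  · simp [sd_sq]
  have hn' : (0 : ℝ) < n := by exact_mod_cast hn
  have hsum : ∑ i, (1 + (matchCount 1 x d i : ℝ)) = 2 * n := by
    rw [Finset.sum_add_distrib]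
    have : (∑ i, (matchCount 1 x d i : ℝ)) = n := by exact_mod_cast sum_matchCount hopp htie
    rw [this]
    simp
    ring
  have hw : ∀ i, matchWeight 1 x d i ^ 2 * (σ2 (x i) (d i) : ℝ) ≤
      (1 / (n : ℝ)) ^ 2 * hi * κ * (1 + (matchCount 1 x d i : ℝ)) := fun i => by
    have e : matchWeight 1 x d i ^ 2 =
        (1 / (n : ℝ)) ^ 2 * ((1 + (matchCount 1 x d i : ℝ)) * (1 + (matchCount 1 x d i : ℝ))) := by
      simp only [matchWeight, Nat.cast_one, div_one]
      split_ifs <;> ring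
    rw [e]
    have h1 : (σ2 (x i) (d i) : ℝ) ≤ hi := by exact_mod_cast hσ _ _
    have h2 := hκ i
    have h3 : 0 ≤ κ := le_trans (by positivity) h2
    calc _ ≤ (1 / (n : ℝ)) ^ 2 * (κ * (1 + (matchCount 1 x d i : ℝ))) * hi := by gcongr
      _ = _ := by ring
  rw [sd_sq]
  calc _ ≤ ∑ i, (1 / (n : ℝ)) ^ 2 * hi * κ * (1 + (matchCount 1 x d i : ℝ)) :=
        Finset.sum_le_sum fun i _ => hw i
    _ = 2 * hi * κ / n := by
        rw [← Finset.mul_sum, hsum]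
        field_simp

end Match

/-! Bounds on the performance criteria. -/

lemma worstMSE_ge {C : ℝ} (hC : 0 ≤ C) (σ2 : E → Bool → ℝ≥0) (x : Fin n → E)
    (d : Fin n → Bool) (k : Fin n → ℝ) :
    ENNReal.ofReal (matchBias C x d ^ 2) ≤ worstMSE C σ2 x d k := by
  refine le_trans ?_ (le_iSup₂ (f := fun (f : E → Bool → ℝ) (_ : f ∈ FLip (E := E) C) =>
    ∫⁻ y, ENNReal.ofReal ((linEst k y - cate x f) ^ 2) ∂(outcomeLaw σ2 x d f))
    (leastFavorable C x d) (leastFavorable_mem hC x d))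
  rw [lintegral_sq_linEst_sub, sum_mul_leastFavorable, cate_leastFavorable]
  gcongr
  nlinarith [sq_nonneg (sd σ2 x d k)]

lemma worstMSE_match_le {C : ℝ} (hC : 0 ≤ C) (σ2 : E → Bool → ℝ≥0) {x : Fin n → E}
    {d : Fin n → Bool} (hopp : ∀ j, ∃ l, d l ≠ d j)
    (htie : ∀ i l j, i ≠ l → d j ≠ d i → ‖x l - x j‖ ≠ ‖x i - x j‖) :
    worstMSE C σ2 x d (matchWeight 1 x d) ≤
      ENNReal.ofReal (matchBias C x d ^ 2 + sd σ2 x d (matchWeight 1 x d) ^ 2) := by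
  refine iSup₂_le fun f hf => ?_
  rw [lintegral_sq_linEst_sub]
  gcongr ENNReal.ofReal (?_ + _)
  exact sq_le_sq' (neg_le_of_abs_le (abs_bias_match_le hC hopp htie hf))
    ((le_abs_self _).trans (abs_bias_match_le hC hopp htie hf))

lemma gaussianReal_map_abs_Iic (b c : ℝ) :
    ((gaussianReal b 1).map fun z => |z|) (Set.Iic c) = gaussianReal 0 1 {z | |b + z| ≤ c} := by
  have e : gaussianReal b 1 = (gaussianReal 0 1).map (fun z => b + z) := by
    rw [gaussianReal_map_const_add, zero_add]
  rw [e, Measure.map_map (by fun_prop) (by fun_prop), Measure.map_apply (by fun_prop)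
    measurableSet_Iic]
  rfl

/-- If `c < b`, then `|Z| ≤ c` has probability at most that of `Z ≤ c`, which is below `1/2`, hence
below `1 - α`. This is where `α ≤ 1/2` enters. -/
lemma le_cv {α b : ℝ} (hα : 0 < α) (hα' : α ≤ 1 / 2) : b ≤ cv α b := by
  have hm : Measurable fun z : ℝ => |z| := by fun_prop
  have : IsProbabilityMeasure ((gaussianReal b 1).map fun z => |z|) :=
    Measure.isProbabilityMeasure_map hm.aemeasurable
  by_contra! h
  have h1 := le_measure_Iic_quantile (ν := (gaussianReal b 1).map fun z => |z|)
    (p := 1 - α) (by linarith) (by linarith)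
  change ENNReal.ofReal (1 - α) ≤
    ((gaussianReal b 1).map fun z => |z|) (Set.Iic (cv α b)) at h1
  rw [Measure.map_apply hm measurableSet_Iic] at h1
  have h2 : ENNReal.ofReal (1 - α) < gaussianReal b 1 (Set.Iic b) :=
    h1.trans_lt (lt_of_le_of_lt (measure_mono fun z hz => (le_abs_self z).trans hz)
      (gaussianReal_Iic_lt_Iic one_ne_zero h))
  rw [gaussianReal_Iic_mean] at h2
  have h3 : (1 / 2 : ℝ≥0∞) = ENNReal.ofReal (1 / 2) := by
    rw [ENNReal.ofReal_div_of_pos (by norm_num)]; simp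
  rw [h3, ENNReal.ofReal_lt_ofReal_iff (by norm_num)] at h2
  linarith

lemma cv_le {α b q : ℝ} (hα' : α < 1) (hb : 0 ≤ b)
    -- The bound comes from `|b + z| ≤ b + |z|`: the level `b + q` already carries mass `1 - α`.
    (hq : ENNReal.ofReal (1 - α) ≤ gaussianReal 0 1 {z | |z| ≤ q}) : cv α b ≤ b + q := by
  refine csInf_le ⟨0, fun c hc => le_of_not_gt fun h0 => ?_⟩ ?_
  · have hc : ENNReal.ofReal (1 - α) ≤ _ := hc
    rw [gaussianReal_map_abs_Iic] at hc
    have : {z : ℝ | |b + z| ≤ c} = ∅ := Set.eq_empty_of_forall_notMem fun z hz =>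
      absurd ((abs_nonneg (b + z)).trans hz) (not_le.2 h0)
    rw [this, measure_empty] at hc
    exact absurd hc (by simp; linarith)
  · change ENNReal.ofReal (1 - α) ≤ _
    rw [gaussianReal_map_abs_Iic]
    refine hq.trans (measure_mono fun z hz => ?_)
    have hz : |z| ≤ q := hz
    change |b + z| ≤ b + q
    calc |b + z| ≤ |b| + |z| := abs_add_le _ _
      _ ≤ b + q := by rw [abs_of_nonneg hb]; gcongr

lemma flciLength_ge {C α : ℝ} (hC : 0 ≤ C) (hα : 0 < α) (hα' : α ≤ 1 / 2)
    {σ2 : E → Bool → ℝ≥0} (hσ : ∀ z b, 0 < σ2 z b) (hn : 0 < n) (x : Fin n → E)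
    (d : Fin n → Bool) (k : Fin n → ℝ) :
    ((2 * matchBias C x d : ℝ) : EReal) ≤ flciLength α C σ2 x d k := by
  unfold flciLength
  split_ifs with h
  · exact le_top
  · have hs := sd_pos_of_maxBias_ne_top hC hσ hn x d k h
    have hb := (matchBias_le_toReal_maxBias hC σ2 x d k h).1
    have hc := le_cv (b := (maxBias C σ2 x d k).toReal / sd σ2 x d k) hα hα'
    rw [div_le_iff₀ hs] at hc
    exact_mod_cast (by linarith)

lemma flciLength_match_le {C α q : ℝ} (hC : 0 ≤ C) (hα' : α < 1)
    (hq : ENNReal.ofReal (1 - α) ≤ gaussianReal 0 1 {z | |z| ≤ q})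
    {σ2 : E → Bool → ℝ≥0} (hσ : ∀ z b, 0 < σ2 z b) (hn : 0 < n) {x : Fin n → E}
    {d : Fin n → Bool} (hopp : ∀ j, ∃ l, d l ≠ d j)
    (htie : ∀ i l j, i ≠ l → d j ≠ d i → ‖x l - x j‖ ≠ ‖x i - x j‖) :
    flciLength α C σ2 x d (matchWeight 1 x d) ≤
      ((2 * matchBias C x d + 2 * q * sd σ2 x d (matchWeight 1 x d) : ℝ) : EReal) := by
  have hb := maxBias_match hC σ2 hopp htie
  have h : maxBias C σ2 x d (matchWeight 1 x d) ≠ ⊤ := by rw [hb]; exact EReal.coe_ne_top _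
  have hs := sd_pos_of_maxBias_ne_top hC hσ hn x d _ h
  rw [flciLength, if_neg h, hb, EReal.toReal_coe]
  have hc := cv_le (b := matchBias C x d / sd σ2 x d (matchWeight 1 x d)) hα'
    (div_nonneg (matchBias_nonneg hC x d) hs.le) hq
  have hc2 := mul_le_mul_of_nonneg_right hc hs.le
  rw [add_mul, div_mul_cancel₀ _ hs.ne'] at hc2
  exact_mod_cast (by linarith)

/-- Take `g` to be minus the least favorable function, so `Lg = matchBias` while the estimator is
centred at zero. An excess below `2 * matchBias` requires the estimator to exceed `z_{1-α} sd`
strictly, because its own worst-case bias is at least `matchBias`. This has probability less than `α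
≤ β`. -/
lemma worstExcess_ge {C α β : ℝ} (hC : 0 ≤ C) (hα : 0 < α) (hαβ : α ≤ β) (hβ : β < 1)
    {σ2 : E → Bool → ℝ≥0} (hσ : ∀ z b, 0 < σ2 z b) (hn : 0 < n) (x : Fin n → E)
    (d : Fin n → Bool) (k : Fin n → ℝ) :
    ((2 * matchBias C x d : ℝ) : EReal) ≤ worstExcess α β C σ2 x d k := by
  set g : E → Bool → ℝ := -leastFavorable C x d with hg
  have hgm : g ∈ FLip (E := E) C := neg_mem_FLip (leastFavorable_mem hC x d)
  have hgc : cate x g = matchBias C x d := by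
    rw [hg, cate_neg, cate_leastFavorable, neg_neg]
  have hgs : ∑ i, k i * g (x i) (d i) = 0 := by
    have := sum_mul_leastFavorable C x d k
    simpa [hg] using this
  refine le_trans ?_ (le_iSup₂ (f := fun (g : E → Bool → ℝ) (_ : g ∈ FLip (E := E) C) =>
    sInf {c : EReal | ENNReal.ofReal β ≤
      outcomeLaw σ2 x d g {y | (cate x g : EReal) - lowerEndpoint α C σ2 x d k y ≤ c}}) g hgm)
  refine le_sInf fun c hc => le_of_not_gt fun hlt => ?_
  have hc : ENNReal.ofReal β ≤
      outcomeLaw σ2 x d g {y | (cate x g : EReal) - lowerEndpoint α C σ2 x d k y ≤ c} := hc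
  obtain ⟨r, hcr, hr⟩ := EReal.lt_iff_exists_real_btwn.1 hlt
  have hr : r < 2 * matchBias C x d := by exact_mod_cast hr
  have hβ0 : 0 < ENNReal.ofReal β := by simpa using hα.trans_le hαβ
  -- With infinite bias the lower endpoint is `-∞`, so the excess length is `+∞` for every outcome.
  by_cases htop : maxBias C σ2 x d k = ⊤
  · have : {y | (cate x g : EReal) - lowerEndpoint α C σ2 x d k y ≤ c} = ∅ := by
      refine Set.eq_empty_of_forall_notMem fun y hy => ?_
      have hy : (cate x g : EReal) - lowerEndpoint α C σ2 x d k y ≤ c := hy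
      rw [lowerEndpoint, htop, EReal.sub_top, EReal.bot_sub, EReal.coe_sub_bot] at hy
      exact absurd (hcr.trans_le le_top) (not_lt.2 hy)
    rw [this, measure_empty] at hc
    exact absurd hc (not_le.2 hβ0)
  obtain ⟨hb, hb'⟩ := matchBias_le_toReal_maxBias hC σ2 x d k htop
  have hs := sd_pos_of_maxBias_ne_top hC hσ hn x d k htop
  set s := sd σ2 x d k
  set b := (maxBias C σ2 x d k).toReal
  set δ := 2 * matchBias C x d - r with hδ
  have hδ0 : 0 < δ := sub_pos.2 hr
  have hsub : {y | (cate x g : EReal) - lowerEndpoint α C σ2 x d k y ≤ c} ⊆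
      linEst k ⁻¹' Set.Ici (zq (1 - α) * s + δ) := fun y hy => by
    have hy : (cate x g : EReal) - lowerEndpoint α C σ2 x d k y ≤ c := hy
    rw [lowerEndpoint, ← hb', hgc] at hy
    have h2 : ((matchBias C x d - (linEst k y - b - zq (1 - α) * s) : ℝ) : EReal) < (r : ℝ) := by
      refine lt_of_le_of_lt ?_ hcr
      exact_mod_cast hy
    have h3 : matchBias C x d - (linEst k y - b - zq (1 - α) * s) < r := by exact_mod_cast h2
    change zq (1 - α) * s + δ ≤ linEst k y
    linarith
  have h4 : outcomeLaw σ2 x d g (linEst k ⁻¹' Set.Ici (zq (1 - α) * s + δ)) < ENNReal.ofReal α := by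
    rw [← Measure.map_apply (by fun_prop) measurableSet_Ici, map_linEst,
      Measure.map_apply (by fun_prop) measurableSet_Ici, hgs]
    -- Half of the margin `δ` makes the cutoff inequality strict; the other half moves the cutoff
    -- past the quantile, where the mass strictly exceeds `1 - α`.
    have hset : (fun z => 0 + s * z) ⁻¹' Set.Ici (zq (1 - α) * s + δ) ⊆
        (Set.Iic (zq (1 - α) + δ / (2 * s)))ᶜ := fun z hz => by
      have hz : zq (1 - α) * s + δ ≤ 0 + s * z := hz
      simp only [Set.mem_compl_iff, Set.mem_Iic, not_le]
      have : (zq (1 - α) + δ / (2 * s)) * s = zq (1 - α) * s + δ / 2 := by field_simp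
      refine lt_of_mul_lt_mul_right ?_ hs.le
      rw [this]; linarith
    refine (measure_mono hset).trans_lt ?_
    rw [prob_compl_eq_one_sub measurableSet_Iic]
    have h5 : ENNReal.ofReal (1 - α) < gaussianReal 0 1 (Set.Iic (zq (1 - α) + δ / (2 * s))) :=
      (le_measure_Iic_quantile (by linarith) (by linarith)).trans_lt
        (gaussianReal_Iic_lt_Iic one_ne_zero (by simp only [zq]; linarith [div_pos hδ0 (by positivity : 0 < 2 * s)]))
    refine ENNReal.sub_lt_of_lt_add prob_le_one ?_
    calc (1 : ℝ≥0∞) = ENNReal.ofReal α + ENNReal.ofReal (1 - α) := by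
          rw [← ENNReal.ofReal_add hα.le (by linarith)]; simp
      _ < _ := ENNReal.add_lt_add_left ENNReal.ofReal_ne_top h5
  exact absurd (hc.trans (measure_mono hsub)) (not_le.2 (h4.trans_le (ENNReal.ofReal_le_ofReal hαβ)))

lemma worstExcess_match_le {C α β q : ℝ} (hC : 0 ≤ C)
    (hq : ENNReal.ofReal β ≤ gaussianReal 0 1 {z | |z| ≤ q})
    (σ2 : E → Bool → ℝ≥0) {x : Fin n → E} {d : Fin n → Bool} (hopp : ∀ j, ∃ l, d l ≠ d j)
    (htie : ∀ i l j, i ≠ l → d j ≠ d i → ‖x l - x j‖ ≠ ‖x i - x j‖) :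
    worstExcess α β C σ2 x d (matchWeight 1 x d) ≤
      ((2 * matchBias C x d + (|zq (1 - α)| + q) * sd σ2 x d (matchWeight 1 x d) : ℝ) : EReal) := by
  refine iSup₂_le fun g hg => sInf_le ?_
  change ENNReal.ofReal β ≤ _
  set k := matchWeight 1 x d
  set s := sd σ2 x d k with hs
  have hs0 : 0 ≤ s := sd_nonneg _ _ _ _
  have h1 := abs_bias_match_le hC hopp htie hg
  refine hq.trans ?_
  set A : Set ℝ := {z | cate x g - z + matchBias C x d + zq (1 - α) * s ≤
    2 * matchBias C x d + (|zq (1 - α)| + q) * s} with hA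
  have hAm : MeasurableSet A := measurableSet_le (by fun_prop) (by fun_prop)
  have h2 : {y | (cate x g : EReal) - lowerEndpoint α C σ2 x d k y ≤
      ((2 * matchBias C x d + (|zq (1 - α)| + q) * s : ℝ) : EReal)} = linEst k ⁻¹' A := by
    ext y
    change (cate x g : EReal) - lowerEndpoint α C σ2 x d k y ≤ _ ↔ linEst k y ∈ A
    simp only [hA, Set.mem_ofPred_eq]
    rw [lowerEndpoint, maxBias_match hC σ2 hopp htie, ← EReal.coe_sub, ← EReal.coe_sub,
      ← EReal.coe_sub, EReal.coe_le_coe_iff, ← hs]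
    constructor <;> intro h <;> linarith
  rw [h2, ← Measure.map_apply (by fun_prop) hAm, map_linEst, Measure.map_apply (by fun_prop) hAm]
  -- On `|z| ≤ q` the noise costs at most `q * s`, and the bias of `g` costs at most one further
  -- `matchBias`.
  refine measure_mono fun z hz => ?_
  have hz : |z| ≤ q := hz
  simp only [hA, Set.mem_preimage, Set.mem_ofPred_eq]
  have h3 : -(s * z) ≤ q * s := by nlinarith [neg_abs_le z]
  have h4 : zq (1 - α) * s ≤ |zq (1 - α)| * s := by gcongr; exact le_abs_self _
  have h5 := neg_le_of_abs_le h1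
  linarith

end Deterministic

/-! ### Squeezing the ratio to one -/

lemma tendsto_div_one_of_squeeze_ereal {L s : ℕ → ℝ} {c : ℝ} {mat opt : ℕ → EReal}
    (hL : ∀ᶠ n in atTop, 0 < L n) (h1 : ∀ᶠ n in atTop, (L n : EReal) ≤ opt n)
    (h2 : ∀ n, opt n ≤ mat n) (h3 : ∀ᶠ n in atTop, mat n ≤ ((L n + c * s n : ℝ) : EReal))
    (hs : Tendsto (fun n => s n / L n) atTop (𝓝 0)) :
    Tendsto (fun n => mat n / opt n) atTop (𝓝 1) := by
  have hu : Tendsto (fun n => 1 + c * (s n / L n)) atTop (𝓝 1) := by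
    simpa using (hs.const_mul c).const_add 1
  -- The bounds eventually exclude infinite values, so the quotient is computed in `ℝ`, where it
  -- lies between `1` and `1 + c * (s / L)`.
  have key : Tendsto (fun n => (mat n).toReal / (opt n).toReal) atTop (𝓝 1) := by
    refine tendsto_of_tendsto_of_tendsto_of_le_of_le' tendsto_const_nhds hu ?_ ?_
    all_goals
      filter_upwards [hL, h1, h3] with n hL h1 h3
      obtain ⟨o, ho⟩ : ∃ o : ℝ, opt n = o := ⟨(opt n).toReal, (EReal.coe_toReal
        (((h2 n).trans h3).trans_lt (EReal.coe_lt_top _)).ne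
        ((EReal.bot_lt_coe _).trans_le h1).ne').symm⟩
      obtain ⟨m, hm⟩ : ∃ m : ℝ, mat n = m := ⟨(mat n).toReal, (EReal.coe_toReal
        (h3.trans_lt (EReal.coe_lt_top _)).ne
        ((EReal.bot_lt_coe _).trans_le (h1.trans (h2 n))).ne').symm⟩
      have h2 := h2 n
      rw [ho] at h1 h2 ⊢
      rw [hm] at h2 h3 ⊢
      have h1 : L n ≤ o := by exact_mod_cast h1
      have h2 : o ≤ m := by exact_mod_cast h2
      have h3 : m ≤ L n + c * s n := by exact_mod_cast h3
      have ho : 0 < o := hL.trans_le h1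
      simp only [EReal.toReal_coe]
    · rwa [one_le_div ho]
    · have h4 : m / o ≤ m / L n := by gcongr; linarith
      refine h4.trans ?_
      rw [div_le_iff₀ hL, add_mul, mul_assoc, div_mul_cancel₀ _ hL.ne']
      linarith
  have key2 := (continuous_coe_real_ereal.tendsto _).comp key
  refine (key2.congr' ?_)
  filter_upwards [hL, h1, h3] with n hL h1 h3
  simp only [Function.comp, EReal.coe_div]
  rw [EReal.coe_toReal, EReal.coe_toReal]
  · exact (((h2 n).trans h3).trans_lt (EReal.coe_lt_top _)).ne
  · exact ((EReal.bot_lt_coe _).trans_le h1).ne'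
  · exact (h3.trans_lt (EReal.coe_lt_top _)).ne
  · exact ((EReal.bot_lt_coe _).trans_le (h1.trans (h2 n))).ne'

lemma tendsto_div_one_of_squeeze_ennreal {L s : ℕ → ℝ} {mat opt : ℕ → ℝ≥0∞}
    (hL : ∀ᶠ n in atTop, 0 < L n) (h1 : ∀ᶠ n in atTop, ENNReal.ofReal (L n ^ 2) ≤ opt n)
    (h2 : ∀ n, opt n ≤ mat n)
    (h3 : ∀ᶠ n in atTop, mat n ≤ ENNReal.ofReal (L n ^ 2 + s n ^ 2))
    (hs : Tendsto (fun n => s n / L n) atTop (𝓝 0)) :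
    Tendsto (fun n => mat n / opt n) atTop (𝓝 1) := by
  have hu : Tendsto (fun n => ENNReal.ofReal (1 + (s n / L n) ^ 2)) atTop (𝓝 1) := by
    have : Tendsto (fun n => 1 + (s n / L n) ^ 2) atTop (𝓝 1) := by
      simpa using (hs.pow 2).const_add 1
    simpa using ENNReal.tendsto_ofReal this
  refine tendsto_of_tendsto_of_tendsto_of_le_of_le' tendsto_const_nhds hu ?_ ?_
  · filter_upwards [hL, h1, h3] with n hL h1 h3
    have hpos : 0 < ENNReal.ofReal (L n ^ 2) := ENNReal.ofReal_pos.2 (pow_pos hL 2)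
    rw [ENNReal.le_div_iff_mul_le (Or.inl (hpos.trans_le h1).ne')
      (Or.inl (((h2 n).trans h3).trans_lt ENNReal.ofReal_lt_top).ne), one_mul]
    exact h2 n
  · filter_upwards [hL, h1, h3] with n hL h1 h3
    calc mat n / opt n ≤ ENNReal.ofReal (L n ^ 2 + s n ^ 2) / ENNReal.ofReal (L n ^ 2) := by
          gcongr
      _ = ENNReal.ofReal (1 + (s n / L n) ^ 2) := by
          rw [← ENNReal.ofReal_div_of_pos (by positivity)]
          congr 1
          field_simp

/-! ### The three criteria when bias dominates -/

section

variable {E : Type*} [NormedAddCommGroup E] {C : ℝ} {σ2 : E → Bool → ℝ≥0} {x : ℕ → E}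
  {d : ℕ → Bool}

/-- The variance of the matching estimator is negligible relative to its squared worst-case bias,
in a sample without ties. -/
structure BiasDominates (C : ℝ) (σ2 : E → Bool → ℝ≥0) (x : ℕ → E) (d : ℕ → Bool) : Prop where
  exists_opposite : ∀ᶠ n : ℕ in atTop, ∀ j : Fin n, ∃ l : Fin n, d l ≠ d j
  no_ties : ∀ i l j : ℕ, i ≠ l → d j ≠ d i → ‖x l - x j‖ ≠ ‖x i - x j‖
  bias_pos : ∀ᶠ n : ℕ in atTop, 0 < matchBias C (fun i : Fin n => x i) (fun i => d i)
  tendsto : Tendsto (fun n : ℕ => sd σ2 (fun i : Fin n => x i) (fun i => d i)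
    (matchWeight 1 (fun i : Fin n => x i) (fun i => d i)) /
      matchBias C (fun i : Fin n => x i) (fun i => d i)) atTop (𝓝 0)

namespace BiasDominates

lemma no_ties_fin (h : BiasDominates C σ2 x d) (n : ℕ) (i l j : Fin n) (hil : i ≠ l)
    (hd : d j ≠ d i) : ‖x l - x j‖ ≠ ‖x i - x j‖ :=
  h.no_ties i l j (fun e => hil (Fin.ext e)) hd

lemma tendsto_two_mul (h : BiasDominates C σ2 x d) :
    Tendsto (fun n : ℕ => sd σ2 (fun i : Fin n => x i) (fun i => d i)
      (matchWeight 1 (fun i : Fin n => x i) (fun i => d i)) /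
        (2 * matchBias C (fun i : Fin n => x i) (fun i => d i))) atTop (𝓝 0) := by
  have := h.tendsto.const_mul (1 / 2)
  rw [mul_zero] at this
  refine this.congr fun n => ?_
  rw [mul_comm 2, ← div_div]
  ring

lemma worstMSE (hC : 0 ≤ C) (h : BiasDominates C σ2 x d) :
    Tendsto (fun n : ℕ =>
      worstMSE C σ2 (fun i : Fin n => x i) (fun i => d i)
        (matchWeight 1 (fun i : Fin n => x i) (fun i => d i)) /
          ⨅ k : Fin n → ℝ, worstMSE C σ2 (fun i : Fin n => x i) (fun i => d i) k)
      atTop (𝓝 1) := by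
  refine tendsto_div_one_of_squeeze_ennreal h.bias_pos
    (Eventually.of_forall fun n => le_iInf fun k => worstMSE_ge hC _ _ _ _)
    (fun n => iInf_le _ _) ?_ h.tendsto
  filter_upwards [h.exists_opposite] with n hn
  exact worstMSE_match_le hC σ2 hn (h.no_ties_fin n)

lemma flciLength (hC : 0 ≤ C) (hσ : ∀ z b, 0 < σ2 z b) (h : BiasDominates C σ2 x d) {α : ℝ}
    (hα : 0 < α) (hα' : α ≤ 1 / 2) :
    Tendsto (fun n : ℕ =>
      flciLength α C σ2 (fun i : Fin n => x i) (fun i => d i)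
        (matchWeight 1 (fun i : Fin n => x i) (fun i => d i)) /
          ⨅ k : Fin n → ℝ, flciLength α C σ2 (fun i : Fin n => x i) (fun i => d i) k)
      atTop (𝓝 1) := by
  obtain ⟨q, -, hq⟩ := exists_le_gaussianReal_abs_le (p := 1 - α) (by linarith)
  refine tendsto_div_one_of_squeeze_ereal (c := 2 * q)
    (h.bias_pos.mono fun n hn => mul_pos two_pos hn) ?_
    (fun n => iInf_le _ _) ?_ h.tendsto_two_mul
  · filter_upwards [eventually_gt_atTop 0] with n hn
    exact le_iInf fun k => flciLength_ge hC hα hα' hσ hn _ _ _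
  · filter_upwards [h.exists_opposite, eventually_gt_atTop 0] with n hn hn0
    exact flciLength_match_le hC (by linarith) hq hσ hn0 hn (h.no_ties_fin n)

lemma worstExcess (hC : 0 ≤ C) (hσ : ∀ z b, 0 < σ2 z b) (h : BiasDominates C σ2 x d) {α β : ℝ}
    (hα : 0 < α) (hαβ : α ≤ β) (hβ : β < 1) :
    Tendsto (fun n : ℕ =>
      worstExcess α β C σ2 (fun i : Fin n => x i) (fun i => d i)
        (matchWeight 1 (fun i : Fin n => x i) (fun i => d i)) /
          ⨅ k : Fin n → ℝ, worstExcess α β C σ2 (fun i : Fin n => x i) (fun i => d i) k)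
      atTop (𝓝 1) := by
  obtain ⟨q, -, hq⟩ := exists_le_gaussianReal_abs_le hβ
  refine tendsto_div_one_of_squeeze_ereal (c := |zq (1 - α)| + q)
    (h.bias_pos.mono fun n hn => mul_pos two_pos hn) ?_
    (fun n => iInf_le _ _) ?_ h.tendsto_two_mul
  · filter_upwards [eventually_gt_atTop 0] with n hn
    exact le_iInf fun k => worstExcess_ge hC hα hαβ hβ hσ hn _ _ _
  · filter_upwards [h.exists_opposite] with n hn
    exact worstExcess_match_le hC hq σ2 hn (h.no_ties_fin n)

end BiasDominates

end

/-! ### Concentration for independent draws -/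

section IID

variable {Ω β : Type*} [MeasurableSpace Ω] [MeasurableSpace β] {μ : Measure Ω}
  [IsProbabilityMeasure μ] {Z : ℕ → Ω → β} {ν : Measure β}

/-- Conditioning on the `i`-th draw, the remaining draws stay independent. -/
lemma lintegral_prod_draws (hZ : ∀ i, Measurable (Z i)) (hindep : iIndepFun Z μ)
    (hν : ∀ i, μ.map (Z i) = ν) {g : β → β → ℝ≥0∞} (hg : Measurable (Function.uncurry g))
    {i : ℕ} {s : Finset ℕ} (hi : i ∉ s) :
    ∫⁻ ω, ∏ l ∈ s, g (Z i ω) (Z l ω) ∂μ = ∫⁻ z, (∫⁻ w, g z w ∂ν) ^ s.card ∂ν := by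
  have hgz : ∀ z, Measurable (g z) := fun z => hg.of_uncurry_left
  have hW : Measurable fun ω (t : s) => Z t ω := measurable_pi_lambda _ fun t => hZ t
  have hind : IndepFun (Z i) (fun ω (t : s) => Z t ω) μ :=
    (hindep.indepFun_finset {i} s (by simpa using hi) hZ).comp
      (φ := fun (w : ({i} : Finset ℕ) → β) => w ⟨i, by simp⟩) (ψ := id)
      (measurable_pi_apply _) measurable_id
  have hmap := (indepFun_iff_map_prod_eq_prod_map_map (hZ i).aemeasurable hW.aemeasurable).1 hind
  have := Measure.isProbabilityMeasure_map hW.aemeasurable (μ := μ)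
  have hF : Measurable fun p : β × (s → β) => ∏ t : s, g p.1 (p.2 t) := by
    refine Finset.measurable_prod _ fun t _ => ?_
    exact hg.comp (measurable_fst.prodMk ((measurable_pi_apply t).comp measurable_snd))
  have e1 : ∫⁻ ω, ∏ l ∈ s, g (Z i ω) (Z l ω) ∂μ =
      ∫⁻ p, ∏ t : s, g p.1 (p.2 t) ∂(μ.map fun ω => (Z i ω, fun t : s => Z t ω)) := by
    rw [lintegral_map hF ((hZ i).prodMk hW)]
    refine lintegral_congr fun ω => ?_
    exact (Finset.prod_coe_sort s fun l => g (Z i ω) (Z l ω)).symm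
  rw [e1, hmap, lintegral_prod _ hF.aemeasurable, hν i]
  refine lintegral_congr fun z => ?_
  have hFz : Measurable fun y : s → β => ∏ t : s, g (z, y).1 ((z, y).2 t) :=
    hF.comp (measurable_const.prodMk measurable_id)
  rw [lintegral_map hFz hW]
  have h2 : iIndepFun (fun l ω => g z (Z l ω)) μ :=
    hindep.comp (fun _ => g z) fun _ => hgz z
  have e2 := lintegral_prod_eq_prod_lintegral_of_indepFun s (fun l ω => g z (Z l ω)) h2
    (fun l => (hgz z).comp (hZ l))
  calc ∫⁻ ω, ∏ t : s, g z (Z t ω) ∂μ = ∫⁻ ω, ∏ l ∈ s, g z (Z l ω) ∂μ :=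
        lintegral_congr fun ω => Finset.prod_coe_sort s fun l => g z (Z l ω)
    _ = ∏ l ∈ s, ∫⁻ ω, g z (Z l ω) ∂μ := e2
    _ = ∏ _l ∈ s, ∫⁻ w, g z w ∂ν := by
        refine Finset.prod_congr rfl fun l _ => ?_
        rw [← hν l, lintegral_map (hgz z) (hZ l)]
    _ = _ := Finset.prod_const _

lemma lintegral_prod_draws_le [IsProbabilityMeasure ν] (hZ : ∀ i, Measurable (Z i))
    (hindep : iIndepFun Z μ) (hν : ∀ i, μ.map (Z i) = ν) {g : β → β → ℝ≥0∞}
    (hg : Measurable (Function.uncurry g)) {i : ℕ} {s : Finset ℕ} (hi : i ∉ s) {q : ℝ≥0∞}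
    (hq : ∀ᵐ z ∂ν, ∫⁻ w, g z w ∂ν ≤ q) :
    ∫⁻ ω, ∏ l ∈ s, g (Z i ω) (Z l ω) ∂μ ≤ q ^ s.card := by
  rw [lintegral_prod_draws hZ hindep hν hg hi]
  calc _ ≤ ∫⁻ _, q ^ s.card ∂ν := lintegral_mono_ae (hq.mono fun z hz => by gcongr)
    _ = _ := by simp

/-- The probability that no other draw is related to the `i`-th one. -/
lemma measure_forall_notMem_le [IsProbabilityMeasure ν] (hZ : ∀ i, Measurable (Z i))
    (hindep : iIndepFun Z μ) (hν : ∀ i, μ.map (Z i) = ν) {R : Set (β × β)}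
    (hR : MeasurableSet R) {i : ℕ} {s : Finset ℕ} (hi : i ∉ s) {t : ℝ} (ht : 0 ≤ t)
    (h : ∀ᵐ z ∂ν, ENNReal.ofReal t ≤ ν {w | (z, w) ∈ R}) :
    μ {ω | ∀ l ∈ s, (Z i ω, Z l ω) ∉ R} ≤ ENNReal.ofReal (Real.exp (-(t * s.card))) := by
  classical
  -- The product of these indicators is the indicator of the event.
  let g : β → β → ℝ≥0∞ := fun z w => Rᶜ.indicator 1 (z, w)
  have hg : Measurable (Function.uncurry g) := measurable_one.indicator hR.compl
  have hsec : ∀ z, MeasurableSet {w | (z, w) ∈ R} := fun z => measurable_prodMk_left hR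
  have e : μ {ω | ∀ l ∈ s, (Z i ω, Z l ω) ∉ R} = ∫⁻ ω, ∏ l ∈ s, g (Z i ω) (Z l ω) ∂μ := by
    have hm : MeasurableSet {ω | ∀ l ∈ s, (Z i ω, Z l ω) ∉ R} := by
      have : {ω | ∀ l ∈ s, (Z i ω, Z l ω) ∉ R} = ⋂ l ∈ s, (fun ω => (Z i ω, Z l ω)) ⁻¹' Rᶜ := by
        ext ω; simp
      rw [this]
      exact Finset.measurableSet_biInter s fun l _ => ((hZ i).prodMk (hZ l)) hR.compl
    rw [← lintegral_indicator_one hm]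
    refine lintegral_congr fun ω => ?_
    by_cases hω : ∀ l ∈ s, (Z i ω, Z l ω) ∉ R
    · rw [Set.indicator_of_mem (by exact hω)]
      exact (Finset.prod_eq_one fun l hl =>
        Set.indicator_of_mem (show (Z i ω, Z l ω) ∈ Rᶜ from hω l hl) 1).symm
    · rw [Set.indicator_of_notMem (by exact hω)]
      push Not at hω
      obtain ⟨l, hl, hlR⟩ := hω
      exact (Finset.prod_eq_zero hl (Set.indicator_of_notMem
        (show (Z i ω, Z l ω) ∉ Rᶜ from fun h => h hlR) 1)).symm
  rw [e]
  have hq : ∀ᵐ z ∂ν, ∫⁻ w, g z w ∂ν ≤ ENNReal.ofReal (Real.exp (-t)) := by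
    filter_upwards [h] with z hz
    have : ∫⁻ w, g z w ∂ν = ν {w | (z, w) ∈ R}ᶜ := by
      rw [← lintegral_indicator_one (hsec z).compl]; rfl
    rw [this, prob_compl_eq_one_sub (hsec z)]
    calc 1 - ν {w | (z, w) ∈ R} ≤ 1 - ENNReal.ofReal t := by gcongr
      _ = ENNReal.ofReal (1 - t) := by rw [ENNReal.ofReal_sub _ ht, ENNReal.ofReal_one]
      _ ≤ _ := ENNReal.ofReal_le_ofReal (by linarith [Real.add_one_le_exp (-t)])
  refine (lintegral_prod_draws_le hZ hindep hν hg hi hq).trans_eq ?_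
  rw [← ENNReal.ofReal_pow (Real.exp_nonneg _), ← Real.exp_nat_mul]
  congr 2; ring

open Classical in
/-- A Chernoff bound for the number of other draws that are related to the `i`-th one. -/
lemma measure_le_card_le [IsProbabilityMeasure ν] (hZ : ∀ i, Measurable (Z i))
    (hindep : iIndepFun Z μ) (hν : ∀ i, μ.map (Z i) = ν) {R : Set (β × β)}
    (hR : MeasurableSet R) {i : ℕ} {s : Finset ℕ} (hi : i ∉ s) {p : ℝ} (hp : 0 ≤ p)
    (h : ∀ᵐ z ∂ν, ν {w | (z, w) ∈ R} ≤ ENNReal.ofReal p) {N : ℝ} (hN : s.card ≤ N) :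
    μ {ω | 4 * (N * p) ≤ ((s.filter fun l => (Z i ω, Z l ω) ∈ R).card : ℝ)} ≤
      ENNReal.ofReal (Real.exp (-(2 * (N * p)))) := by
  -- `g` is `e` on `R` and `1` off it, so its product is the exponential of the count, ready for
  -- Markov's inequality.
  let g : β → β → ℝ≥0∞ := fun z w =>
    1 + R.indicator (fun _ => ENNReal.ofReal (Real.exp 1 - 1)) (z, w)
  have hg : Measurable (Function.uncurry g) :=
    Measurable.const_add (measurable_const.indicator hR) 1
  have hsec : ∀ z, MeasurableSet {w | (z, w) ∈ R} := fun z => measurable_prodMk_left hR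
  have he1 : (1 : ℝ) ≤ Real.exp 1 := Real.one_le_exp zero_le_one
  have hprod : ∀ ω, ∏ l ∈ s, g (Z i ω) (Z l ω) = ENNReal.ofReal
      (Real.exp ((s.filter fun l => (Z i ω, Z l ω) ∈ R).card : ℝ)) := fun ω => by
    have : ∀ l ∈ s, g (Z i ω) (Z l ω) =
        if (Z i ω, Z l ω) ∈ R then ENNReal.ofReal (Real.exp 1) else 1 := fun l _ => by
      by_cases hl : (Z i ω, Z l ω) ∈ R
      · simp only [g, Set.indicator_of_mem hl, if_pos hl]
        rw [← ENNReal.ofReal_one, ← ENNReal.ofReal_add zero_le_one (by linarith)]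
        congr 1; ring
      · simp only [g, Set.indicator_of_notMem hl, if_neg hl, add_zero]
    rw [Finset.prod_congr rfl this, Finset.prod_ite, Finset.prod_const, Finset.prod_const_one,
      mul_one, ← ENNReal.ofReal_pow (Real.exp_nonneg _), ← Real.exp_nat_mul, mul_one]
  have hq : ∀ᵐ z ∂ν, ∫⁻ w, g z w ∂ν ≤ ENNReal.ofReal (Real.exp (2 * p)) := by
    filter_upwards [h] with z hz
    have : ∫⁻ w, g z w ∂ν = 1 + ENNReal.ofReal (Real.exp 1 - 1) * ν {w | (z, w) ∈ R} := by
      simp only [g]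
      rw [lintegral_add_left measurable_const, lintegral_const, measure_univ, mul_one]
      congr 1
      exact lintegral_indicator_const (hsec z) _
    rw [this]
    -- Each factor has mean at most `1 + 2p ≤ exp (2p)`; the moment exponent `2Np` against the
    -- threshold `4Np` leaves `-2Np`.
    have he2 : Real.exp 1 - 1 ≤ 2 := by linarith [Real.exp_one_lt_d9]
    calc 1 + ENNReal.ofReal (Real.exp 1 - 1) * ν {w | (z, w) ∈ R}
        ≤ 1 + ENNReal.ofReal 2 * ENNReal.ofReal p := by gcongr
      _ = ENNReal.ofReal (1 + 2 * p) := by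
          rw [ENNReal.ofReal_add zero_le_one (by positivity), ENNReal.ofReal_mul two_pos.le,
            ENNReal.ofReal_one]
      _ ≤ _ := ENNReal.ofReal_le_ofReal (by linarith [Real.add_one_le_exp (2 * p)])
  have hE := lintegral_prod_draws_le hZ hindep hν hg hi hq
  have hmark := meas_ge_le_lintegral_div (μ := μ)
    (f := fun ω => ∏ l ∈ s, g (Z i ω) (Z l ω)) (ε := ENNReal.ofReal (Real.exp (4 * (N * p))))
    (Finset.measurable_prod s fun l _ => hg.comp ((hZ i).prodMk (hZ l))).aemeasurable
    (by simp [Real.exp_pos]) ENNReal.ofReal_ne_top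
  calc _ ≤ μ {ω | ENNReal.ofReal (Real.exp (4 * (N * p))) ≤ ∏ l ∈ s, g (Z i ω) (Z l ω)} := by
        refine measure_mono fun ω hω => ?_
        have hω : 4 * (N * p) ≤ ((s.filter fun l => (Z i ω, Z l ω) ∈ R).card : ℝ) := hω
        rw [Set.mem_ofPred_eq, hprod]
        gcongr
    _ ≤ _ := hmark
    _ ≤ ENNReal.ofReal (Real.exp (2 * p)) ^ s.card / ENNReal.ofReal (Real.exp (4 * (N * p))) := by
        gcongr
    _ = ENNReal.ofReal (Real.exp (2 * (s.card * p) - 4 * (N * p))) := by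
        rw [← ENNReal.ofReal_pow (Real.exp_nonneg _), ← Real.exp_nat_mul,
          ← ENNReal.ofReal_div_of_pos (Real.exp_pos _), ← Real.exp_sub]
        congr 2; ring
    _ ≤ _ := by
        refine ENNReal.ofReal_le_ofReal (Real.exp_le_exp.2 ?_)
        nlinarith [mul_le_mul_of_nonneg_right hN hp]

end IID

/-! ### Consequences of bounded densities -/

section Density

variable {E : Type*} [NormedAddCommGroup E] [NormedSpace ℝ E] [FiniteDimensional ℝ E]
  [MeasurableSpace E] [BorelSpace E] {vol : Measure E} [vol.IsAddHaarMeasure]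
  {Ω : Type*} [MeasurableSpace Ω] {μ : Measure Ω} [IsProbabilityMeasure μ]

/-- The law of `X` is a mixture over the two arms. The mixing weights are at most one, so the
density bounds add. -/
lemma exists_measure_preimage_le {E : Type*} [MeasurableSpace E] {vol : Measure E} {X : Ω → E} {D : Ω → Bool} (hX : Measurable X)
    (hD : Measurable D)
    (hdens : ∀ d : Bool, HasBoundedDensity vol ((μ[|{ω | D ω = d}]).map X)) :
    ∃ K : ℝ≥0, ∀ B, MeasurableSet B → μ (X ⁻¹' B) ≤ K * vol B := by
  have h1 : ∀ d : Bool, ∃ K : ℝ≥0, ∀ B, MeasurableSet B →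
      μ ({ω | D ω = d} ∩ X ⁻¹' B) ≤ K * vol B := fun d => by
    obtain ⟨g, hg, ⟨K, hK⟩, hgd⟩ := hdens d
    refine ⟨K, fun B hB => ?_⟩
    have hms : MeasurableSet {ω | D ω = d} := hD (measurableSet_singleton d)
    have h2 : (μ[|{ω | D ω = d}]) (X ⁻¹' B) ≤ K * vol B := by
      rw [← Measure.map_apply hX hB, hgd, withDensity_apply _ hB]
      calc _ ≤ ∫⁻ _ in B, K ∂vol := lintegral_mono fun x => hK x
        _ = _ := by simp
    calc μ ({ω | D ω = d} ∩ X ⁻¹' B) = (μ[|{ω | D ω = d}]) (X ⁻¹' B) * μ {ω | D ω = d} :=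
          (cond_mul_eq_inter hms _ _).symm
      _ ≤ (K * vol B) * 1 := by gcongr; exact prob_le_one
      _ = _ := mul_one _
  obtain ⟨K1, hK1⟩ := h1 true
  obtain ⟨K0, hK0⟩ := h1 false
  refine ⟨K1 + K0, fun B hB => ?_⟩
  calc μ (X ⁻¹' B) ≤ μ (({ω | D ω = true} ∩ X ⁻¹' B) ∪ ({ω | D ω = false} ∩ X ⁻¹' B)) :=
        measure_mono fun ω hω => by
          cases h : D ω
          · exact Or.inr ⟨h, hω⟩
          · exact Or.inl ⟨h, hω⟩
    _ ≤ _ := measure_union_le _ _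
    _ ≤ K1 * vol B + K0 * vol B := add_le_add (hK1 B hB) (hK0 B hB)
    _ = _ := by push_cast; ring

/-- Given `X l` and `X j`, a tie puts the independent `X i` on a fixed sphere, which is null. The
case `l = j` is included: the sphere is then a single point. -/
lemma ae_no_ties [Nontrivial E] {X : ℕ → Ω → E} (hX : ∀ i, Measurable (X i))
    (hindep : iIndepFun X μ) {K : ℝ≥0}
    (hK : ∀ i B, MeasurableSet B → μ (X i ⁻¹' B) ≤ K * vol B) :
    ∀ᵐ ω ∂μ, ∀ i l j : ℕ, i ≠ l → i ≠ j → ‖X l ω - X j ω‖ ≠ ‖X i ω - X j ω‖ := by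
  rw [ae_all_iff]; intro i
  rw [ae_all_iff]; intro l
  rw [ae_all_iff]; intro j
  by_cases hil : i = l
  · simp [hil]
  by_cases hij : i = j
  · simp [hij]
  have hind : IndepFun (fun ω => (X l ω, X j ω)) (X i) μ :=
    (hindep.indepFun_finset {l, j} {i} (by simp; tauto) hX).comp
      (φ := fun (w : ({l, j} : Finset ℕ) → E) => (w ⟨l, by simp⟩, w ⟨j, by simp⟩))
      (ψ := fun (w : ({i} : Finset ℕ) → E) => w ⟨i, by simp⟩)
      ((measurable_pi_apply _).prodMk (measurable_pi_apply _)) (measurable_pi_apply _)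
  have hp : Measurable fun ω => (X l ω, X j ω) := (hX l).prodMk (hX j)
  have hmap := (indepFun_iff_map_prod_eq_prod_map_map hp.aemeasurable (hX i).aemeasurable).1 hind
  have := Measure.isProbabilityMeasure_map hp.aemeasurable (μ := μ)
  have := Measure.isProbabilityMeasure_map (hX i).aemeasurable (μ := μ)
  let T : Set ((E × E) × E) := {q | ‖q.1.1 - q.1.2‖ = ‖q.2 - q.1.2‖}
  have hT : MeasurableSet T := measurableSet_eq_fun (by fun_prop) (by fun_prop)
  have h0 : μ ((fun ω => ((X l ω, X j ω), X i ω)) ⁻¹' T) = 0 := by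
    rw [← Measure.map_apply (hp.prodMk (hX i)) hT, hmap, Measure.measure_prod_null hT]
    refine ae_of_all _ fun q => ?_
    have e : Prod.mk q ⁻¹' T = Metric.sphere q.2 ‖q.1 - q.2‖ := by
      ext z; simp [T, eq_comm]
    simp only [Pi.zero_apply]
    rw [e, Measure.map_apply (hX i) Metric.isClosed_sphere.measurableSet]
    refine le_antisymm ((hK i _ Metric.isClosed_sphere.measurableSet).trans ?_) zero_le
    rw [Measure.addHaar_sphere, mul_zero]
  have : ∀ᵐ ω ∂μ, ω ∉ ((fun ω => ((X l ω, X j ω), X i ω)) ⁻¹' T) := measure_eq_zero_iff_ae_notMem.1 h0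
  filter_upwards [this] with ω hω _ _
  exact hω

lemma measure_norm_sub_le {X : ℕ → Ω → E} (hX : ∀ i, Measurable (X i))
    (hindep : iIndepFun X μ) {K : ℝ≥0}
    (hK : ∀ i B, MeasurableSet B → μ (X i ⁻¹' B) ≤ K * vol B) {j l : ℕ} (hjl : j ≠ l) {r : ℝ}
    (hr : 0 ≤ r) :
    μ {ω | ‖X l ω - X j ω‖ ≤ r} ≤
      K * (ENNReal.ofReal (r ^ Module.finrank ℝ E) * vol (Metric.ball 0 1)) := by
  have hind := hindep.indepFun hjl
  have hmap := (indepFun_iff_map_prod_eq_prod_map_map (hX j).aemeasurable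
    (hX l).aemeasurable).1 hind
  have := Measure.isProbabilityMeasure_map (hX j).aemeasurable (μ := μ)
  have := Measure.isProbabilityMeasure_map (hX l).aemeasurable (μ := μ)
  let T : Set (E × E) := {q | ‖q.2 - q.1‖ ≤ r}
  have hT : MeasurableSet T := measurableSet_le (by fun_prop) (by fun_prop)
  change μ ((fun ω => (X j ω, X l ω)) ⁻¹' T) ≤ _
  rw [← Measure.map_apply ((hX j).prodMk (hX l)) hT, hmap, Measure.prod_apply hT]
  calc _ ≤ ∫⁻ _, K * (ENNReal.ofReal (r ^ Module.finrank ℝ E) * vol (Metric.ball 0 1))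
        ∂(μ.map (X j)) := lintegral_mono fun z => by
          have e : Prod.mk z ⁻¹' T = Metric.closedBall z r := by
            ext w; simp [T, dist_eq_norm]
          rw [e, Measure.map_apply (hX l) Metric.isClosed_closedBall.measurableSet]
          refine (hK l _ Metric.isClosed_closedBall.measurableSet).trans ?_
          rw [Measure.addHaar_closedBall _ _ hr]
    _ = _ := by simp

end Density

/-! ### The overlap condition -/

section Overlap

variable {E : Type*} [NormedAddCommGroup E] [NormedSpace ℝ E] [FiniteDimensional ℝ E]
  [Nontrivial E] [MeasurableSpace E] [BorelSpace E] {vol : Measure E} [vol.IsAddHaarMeasure]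
  {ν : Measure (E × Bool)} [IsProbabilityMeasure ν] {K : ℝ≥0}

lemma measurableSet_norm_sub_le_and {E : Type*} [NormedAddCommGroup E] [MeasurableSpace E]
    [BorelSpace E] (z : E) (a : ℝ) (d : Bool) :
    MeasurableSet {w : E × Bool | ‖w.1 - z‖ ≤ a ∧ w.2 = d} := by
  have h1 : MeasurableSet {w : E × Bool | ‖w.1 - z‖ ≤ a} :=
    measurableSet_le (by fun_prop) (by fun_prop)
  exact h1.inter (measurable_snd (measurableSet_singleton d))

/-- The mass of a ball depends continuously on its centre and on its radius. -/
lemma continuous_mass (hK : ∀ B, MeasurableSet B → ν (Prod.fst ⁻¹' B) ≤ K * vol B) (d : Bool) :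
    Continuous fun p : E × ℝ => ν.real {w : E × Bool | ‖w.1 - p.1‖ ≤ p.2 ∧ w.2 = d} := by
  rw [continuous_iff_continuousAt]
  rintro ⟨z, a⟩
  -- The indicator of the moving ball can fail to converge only on the limiting sphere, which is
  -- null.
  have hsphere : ν (Prod.fst ⁻¹' Metric.sphere z a) = 0 := by
    refine le_antisymm ((hK _ Metric.isClosed_sphere.measurableSet).trans ?_) zero_le
    rw [Measure.addHaar_sphere, mul_zero]
  refine (ENNReal.tendsto_toReal (measure_ne_top _ _)).comp ?_
  refine tendsto_measure_of_ae_tendsto_indicator_of_isFiniteMeasure (𝓝 (z, a))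
    (measurableSet_norm_sub_le_and z a d) (fun p => measurableSet_norm_sub_le_and p.1 p.2 d) ?_
  filter_upwards [measure_eq_zero_iff_ae_notMem.1 hsphere] with w hw
  have hne : ‖w.1 - z‖ ≠ a := fun h => hw (by simpa [dist_eq_norm] using h)
  have hc : Continuous fun p : E × ℝ => ‖w.1 - p.1‖ - p.2 := by fun_prop
  rcases lt_or_gt_of_ne hne with h | h
  · filter_upwards [hc.continuousAt.eventually (gt_mem_nhds (show ‖w.1 - z‖ - a < 0 by linarith))]
      with p hp
    exact and_congr_left fun _ => iff_of_true (by linarith) h.le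
  · filter_upwards [hc.continuousAt.eventually (lt_mem_nhds (show 0 < ‖w.1 - z‖ - a by linarith))]
      with p hp
    exact and_congr_left fun _ => iff_of_false (by linarith) (by linarith)

variable {S : Set E} {Glow Gup : ℝ → ℝ}

/-- The overlap bounds at the radius `Glow⁻¹(t)`. -/
lemma eventually_mass_genInv (hK : ∀ B, MeasurableSet B → ν (Prod.fst ⁻¹' B) ≤ K * vol B)
    (hS : S.Nonempty) (hGlow : ∀ a, 0 < a → 0 < Glow a)
    (hG : ∀ᶠ a in 𝓝[>] (0 : ℝ), ∀ x ∈ S, ∀ d : Bool,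
      Glow a ≤ ν.real {w : E × Bool | ‖w.1 - x‖ ≤ a ∧ w.2 = d} ∧
        ν.real {w : E × Bool | ‖w.1 - x‖ ≤ a ∧ w.2 = d} ≤ Gup a) :
    ∀ᶠ t in 𝓝[>] (0 : ℝ), ∀ x ∈ closure S, ∀ d : Bool,
      t ≤ ν.real {w : E × Bool | ‖w.1 - x‖ ≤ genInv Glow t ∧ w.2 = d} ∧
        ν.real {w : E × Bool | ‖w.1 - x‖ ≤ genInv Glow t ∧ w.2 = d} ≤ Gup (genInv Glow t) := by
  obtain ⟨δ, hδ, hGδ⟩ := mem_nhdsGT_iff_exists_Ioo_subset.1 hG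
  have hδ : 0 < δ := hδ
  -- `S` need not be measurable, so the bounds are moved to its closure by continuity of the mass in
  -- the centre.
  have hcl : ∀ a ∈ Set.Ioo 0 δ, ∀ x ∈ closure S, ∀ d : Bool,
      Glow a ≤ ν.real {w : E × Bool | ‖w.1 - x‖ ≤ a ∧ w.2 = d} ∧
        ν.real {w : E × Bool | ‖w.1 - x‖ ≤ a ∧ w.2 = d} ≤ Gup a := fun a ha x hx d => by
    have hc : Continuous fun x : E => ν.real {w : E × Bool | ‖w.1 - x‖ ≤ a ∧ w.2 = d} :=
      (continuous_mass hK d).comp (f := fun x : E => (x, a)) (by fun_prop)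
    have hclosed : IsClosed ((fun x : E => ν.real {w : E × Bool | ‖w.1 - x‖ ≤ a ∧ w.2 = d}) ⁻¹'
        Set.Icc (Glow a) (Gup a)) := isClosed_Icc.preimage hc
    exact closure_minimal (fun x hx => hGδ ha x hx d) hclosed hx
  have hmem : Set.Ioc 0 (Glow (δ / 2)) ∈ 𝓝[>] (0 : ℝ) :=
    Ioc_mem_nhdsGT (hGlow _ (by positivity))
  filter_upwards [hmem] with t ht
  set A := {a : ℝ | 0 < a ∧ t ≤ Glow a} with hA
  -- Taking `δ / 2` keeps the generalized inverse strictly inside the range where the mass bounds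
  -- hold.
  have hδA : δ / 2 ∈ A := ⟨by positivity, ht.2⟩
  have hbdd : BddBelow A := ⟨0, fun a ha => ha.1.le⟩
  have ha0 : 0 ≤ genInv Glow t := le_csInf ⟨_, hδA⟩ fun a ha => ha.1.le
  have haδ : genInv Glow t ≤ δ / 2 := csInf_le hbdd hδA
  -- `Glow` need not be monotone or continuous: the lower bound passes to the infimum along radii `u
  -- n` with `t ≤ Glow (u n)`, by continuity of the mass in the radius.
  obtain ⟨u, -, hu, huA⟩ := exists_seq_tendsto_sInf ⟨_, hδA⟩ hbdd
  have hu : Tendsto u atTop (𝓝 (genInv Glow t)) := hu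
  have hlow : ∀ x ∈ closure S, ∀ d : Bool,
      t ≤ ν.real {w : E × Bool | ‖w.1 - x‖ ≤ genInv Glow t ∧ w.2 = d} := fun x hx d => by
    have hc : Continuous fun a : ℝ => ν.real {w : E × Bool | ‖w.1 - x‖ ≤ a ∧ w.2 = d} :=
      (continuous_mass hK d).comp (f := fun a : ℝ => (x, a)) (by fun_prop)
    refine ge_of_tendsto ((hc.tendsto _).comp hu) ?_
    filter_upwards [hu.eventually (gt_mem_nhds (show genInv Glow t < δ by linarith))] with n hn
    exact (huA n).2.trans (hcl (u n) ⟨(huA n).1, hn⟩ x hx d).1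
  have hapos : 0 < genInv Glow t := by
    refine ha0.lt_of_ne fun h0 => ?_
    obtain ⟨x, hx⟩ := hS
    have h1 := hlow x (subset_closure hx) true
    rw [← h0] at h1
    have h2 : ν {w : E × Bool | ‖w.1 - x‖ ≤ 0 ∧ w.2 = true} = 0 := by
      refine le_antisymm ((measure_mono (t := Prod.fst ⁻¹' {x}) fun w hw => ?_).trans
        ((hK _ (measurableSet_singleton x)).trans (by simp))) zero_le
      have := norm_le_zero_iff.1 hw.1
      exact sub_eq_zero.1 this
    rw [measureReal_def, h2, ENNReal.toReal_zero] at h1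
    exact absurd ht.1 (not_lt.2 h1)
  exact fun x hx d => ⟨hlow x hx d, (hcl _ ⟨hapos, by linarith⟩ x hx d).2⟩

/-- The overlap condition can only hold in dimension at least three. -/
lemma three_le_of_overlap {p : ℕ} (hp : 0 < p) {F : ℝ → ℝ}
    (hF : ∀ᶠ t in 𝓝[>] (0 : ℝ), t ≤ F t)
    (hlim : Tendsto (fun t : ℝ => F t ^ 2 / (t / Real.log t⁻¹) ^ (2 / (p : ℝ) + 1))
      (𝓝[>] 0) (𝓝 0)) : 3 ≤ p := by
  by_contra! hlt
  have hmem : Set.Ioo (0 : ℝ) (Real.exp (-1)) ∈ 𝓝[>] (0 : ℝ) := Ioo_mem_nhdsGT (Real.exp_pos _)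
  obtain ⟨t, ht1, ht2, ht3⟩ :=
    ((hlim.eventually (gt_mem_nhds one_pos)).and (hF.and hmem)).exists
  have hlog : 1 ≤ Real.log t⁻¹ := by
    rw [Real.log_inv]
    have := Real.log_lt_log ht3.1 ht3.2
    rw [Real.log_exp] at this
    linarith
  have ht4 : t ≤ 1 := ht3.2.le.trans (by simp)
  have hu0 : 0 < t / Real.log t⁻¹ := div_pos ht3.1 (by linarith)
  have hut : t / Real.log t⁻¹ ≤ t := div_le_self ht3.1.le hlog
  -- If `p ≤ 2` the exponent is at least `2`, so the denominator is at most `t ^ 2 ≤ F t ^ 2` and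
  -- the ratio cannot tend to zero.
  have hexp : (2 : ℝ) ≤ 2 / (p : ℝ) + 1 := by
    have hp' : (0 : ℝ) < p := by exact_mod_cast hp
    have hp2 : (p : ℝ) ≤ 2 := by exact_mod_cast Nat.lt_succ_iff.1 hlt
    have : 1 ≤ 2 / (p : ℝ) := by rwa [one_le_div hp']
    linarith
  have hle : (t / Real.log t⁻¹) ^ (2 / (p : ℝ) + 1) ≤ F t ^ 2 := by
    calc (t / Real.log t⁻¹) ^ (2 / (p : ℝ) + 1) ≤ (t / Real.log t⁻¹) ^ (2 : ℝ) :=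
          Real.rpow_le_rpow_of_exponent_ge hu0 (hut.trans ht4) hexp
      _ = (t / Real.log t⁻¹) ^ 2 := Real.rpow_two _
      _ ≤ t ^ 2 := by gcongr
      _ ≤ F t ^ 2 := by gcongr; exact ht3.1.le
  rw [div_lt_one (Real.rpow_pos_of_pos hu0 _)] at ht1
  exact absurd ht1 (not_lt.2 hle)

lemma tendsto_log_div_nhdsGT (c : ℝ) (hc : 0 < c) :
    Tendsto (fun n : ℕ => c * Real.log n / n) atTop (𝓝[>] 0) := by
  refine tendsto_nhdsWithin_iff.2 ⟨?_, ?_⟩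
  · have h := (isLittleO_log_rpow_atTop (r := 1) one_pos).tendsto_div_nhds_zero.comp
      tendsto_natCast_atTop_atTop
    have := h.const_mul c
    rw [mul_zero] at this
    refine this.congr fun n => ?_
    simp [mul_div_assoc]
  · filter_upwards [eventually_gt_atTop 1] with n hn
    have hn' : (1 : ℝ) < n := by exact_mod_cast hn
    have := Real.log_pos hn'
    exact Set.mem_Ioi.2 (div_pos (by positivity) (by linarith))

/-- At `t = 8 log n / n` the factor `log t⁻¹ ≥ (log n) / 2` cancels the logarithm in `t`, leaving `t
/ log t⁻¹ ≤ 16 / n`. The square is then of order at most `n ^ (5/(2p) - 1)`, a negative power for `p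
≥ 3`. -/
lemma tendsto_mul_rpow_of_overlap {p : ℕ} (hp : 3 ≤ p) {F : ℝ → ℝ}
    (hlim : Tendsto (fun t : ℝ => F t ^ 2 / (t / Real.log t⁻¹) ^ (2 / (p : ℝ) + 1))
      (𝓝[>] 0) (𝓝 0)) :
    Tendsto (fun n : ℕ => F (8 * Real.log n / n) * (n : ℝ) ^ (9 / (4 * (p : ℝ)))) atTop (𝓝 0) := by
  have hp' : (3 : ℝ) ≤ p := by exact_mod_cast hp
  have hT := tendsto_log_div_nhdsGT 8 (by norm_num)
  set e : ℝ := 2 / (p : ℝ) + 1 with he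
  have he0 : 0 < e := by positivity
  have hexp : 9 / (2 * (p : ℝ)) - e < 0 := by
    rw [he, sub_neg, div_add_one (by positivity), div_lt_div_iff₀ (by positivity) (by positivity)]
    nlinarith
  have hsmall : ∀ᶠ n : ℕ in atTop, 8 * Real.log n ≤ (n : ℝ) ^ (1 / 2 : ℝ) := by
    have h := ((isLittleO_log_rpow_atTop (r := 1 / 2) (by norm_num)).def
      (c := 1 / 8) (by norm_num))
    have h := tendsto_natCast_atTop_atTop.eventually h
    filter_upwards [h, eventually_ge_atTop 1] with n hn hn1
    have hn1' : (1 : ℝ) ≤ n := by exact_mod_cast hn1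
    rw [Real.norm_of_nonneg (Real.log_nonneg hn1'), Real.norm_of_nonneg (by positivity)] at hn
    linarith
  have hbound : ∀ᶠ n : ℕ in atTop,
      (F (8 * Real.log n / n) * (n : ℝ) ^ (9 / (4 * (p : ℝ)))) ^ 2 ≤
        16 ^ e * (n : ℝ) ^ (9 / (2 * (p : ℝ)) - e) := by
    filter_upwards [hT.eventually (hlim.eventually (gt_mem_nhds one_pos)), hsmall,
      eventually_gt_atTop 1] with n h1 h2 h3
    have hn1 : (1 : ℝ) < n := by exact_mod_cast h3
    have hn0 : (0 : ℝ) < n := by linarith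
    have hlogn := Real.log_pos hn1
    have hloglog : Real.log (8 * Real.log n) ≤ 1 / 2 * Real.log n := by
      have := Real.log_le_log (by positivity) h2
      rwa [Real.log_rpow hn0] at this
    have hlogt : 1 / 2 * Real.log n ≤ Real.log (8 * Real.log n / n)⁻¹ := by
      rw [Real.log_inv, Real.log_div (by positivity) hn0.ne']
      linarith
    have hlogt0 : 0 < Real.log (8 * Real.log n / n)⁻¹ := by linarith [hlogt]
    have hu0 : 0 < 8 * Real.log n / n / Real.log (8 * Real.log n / n)⁻¹ := by positivity
    have hu : 8 * Real.log n / n / Real.log (8 * Real.log n / n)⁻¹ ≤ 16 / n := by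
      rw [div_le_iff₀ hlogt0]
      calc 8 * Real.log n / n = 16 / n * (1 / 2 * Real.log n) := by ring
        _ ≤ _ := by gcongr
    rw [div_lt_one (Real.rpow_pos_of_pos hu0 _)] at h1
    have h4 : F (8 * Real.log n / n) ^ 2 ≤ 16 ^ e / (n : ℝ) ^ e := by
      rw [← Real.div_rpow (by norm_num) hn0.le]
      exact h1.le.trans (Real.rpow_le_rpow hu0.le hu he0.le)
    rw [mul_pow, ← Real.rpow_natCast ((n : ℝ) ^ (9 / (4 * (p : ℝ)))), ← Real.rpow_mul hn0.le,
      Real.rpow_sub hn0]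
    have h5 : 9 / (4 * (p : ℝ)) * ((2 : ℕ) : ℝ) = 9 / (2 * (p : ℝ)) := by
      push_cast; field_simp; ring
    rw [h5]
    calc _ ≤ 16 ^ e / (n : ℝ) ^ e * (n : ℝ) ^ (9 / (2 * (p : ℝ))) := by gcongr
      _ = _ := by ring
  have hz : Tendsto (fun n : ℕ => (16 : ℝ) ^ e * (n : ℝ) ^ (9 / (2 * (p : ℝ)) - e)) atTop
      (𝓝 0) := by
    have := (tendsto_rpow_neg_atTop (y := -(9 / (2 * (p : ℝ)) - e)) (by linarith)).comp
      tendsto_natCast_atTop_atTop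
    rw [neg_neg] at this
    simpa using this.const_mul ((16 : ℝ) ^ e)
  have hsq : Tendsto (fun n : ℕ =>
      (F (8 * Real.log n / n) * (n : ℝ) ^ (9 / (4 * (p : ℝ)))) ^ 2) atTop (𝓝 0) :=
    tendsto_of_tendsto_of_tendsto_of_le_of_le' tendsto_const_nhds hz
      (Eventually.of_forall fun n => sq_nonneg _) hbound
  have habs := hsq.sqrt
  simp_rw [Real.sqrt_sq_eq_abs, Real.sqrt_zero] at habs
  exact (tendsto_zero_iff_abs_tendsto_zero _).2 habs

end Overlap

/-! ### Match counts and bias from the geometry of a sample -/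

section FiniteSample

variable {E : Type*} [NormedAddCommGroup E] {x : ℕ → E} {d : ℕ → Bool} {n : ℕ} {a : ℝ}

open Classical in
/-- A unit is only matched to units within distance `a` if such matches are always available. -/
lemma matchCount_le_of_close
    (hclose : ∀ j < n, ∀ b : Bool, ∃ l < n, l ≠ j ∧ ‖x l - x j‖ ≤ a ∧ d l = b) (i : Fin n) :
    matchCount 1 (fun i : Fin n => x i) (fun i => d i) i ≤
      (((Finset.range n).erase i).filter fun l => ‖x l - x i‖ ≤ a).card := by
  rw [matchCount, ← Set.ncard_coe_finset]
  refine Set.ncard_le_ncard_of_injOn (fun j : Fin n => (j : ℕ)) ?_ Fin.val_injective.injOn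
    (Set.toFinite _)
  rintro j ⟨hj, hj'⟩
  rw [Nat.lt_one_iff, Set.ncard_eq_zero (Set.toFinite _), Set.eq_empty_iff_forall_notMem] at hj'
  -- Some unit in the arm of `i` lies within `a` of `j`, so the match `i` of `j` is no farther.
  obtain ⟨l, hln, -, hl, hdl⟩ := hclose j j.2 (d i)
  have h1 := hj' ⟨l, hln⟩
  simp only [Set.mem_ofPred_eq, not_and, not_lt] at h1
  have hji : (j : ℕ) ≠ i := fun h => hj (by rw [h])
  simp only [Finset.coe_filter, Finset.mem_erase, Finset.mem_range, Set.mem_ofPred_eq]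
  exact ⟨⟨hji, j.2⟩, by rw [norm_sub_rev]; exact (h1 hdl).trans hl⟩

open Classical in
-- At least `m / 2` units have no other sample point within `r`, so each adds at least `C * r` to
-- the sum; averaging over `n ≤ 2 * m` units gives the factor `1/4`.
lemma matchBias_ge_of_isolated {C r : ℝ} (hC : 0 ≤ C) (hr : 0 ≤ r) {m : ℕ} (hm : 0 < m)
    (hmn : m ≤ n) (hnm : n ≤ 2 * m) (hopp : ∀ j : Fin n, ∃ l : Fin n, d l ≠ d j)
    (hF : (((Finset.range m).filter fun j => ∃ l < 2 * m, l ≠ j ∧ ‖x l - x j‖ ≤ r).card : ℝ) ≤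
      m / 2) :
    C * r / 4 ≤ matchBias C (fun i : Fin n => x i) (fun i => d i) := by
  set B := (Finset.range m).filter fun j => ∃ l < 2 * m, l ≠ j ∧ ‖x l - x j‖ ≤ r with hB
  set A := (Finset.range m).filter fun j => ¬ ∃ l < 2 * m, l ≠ j ∧ ‖x l - x j‖ ≤ r with hA
  have hAB : B.card + A.card = m := by
    rw [hB, hA, Finset.card_filter_add_card_filter_not, Finset.card_range]
  have hAm : (m : ℝ) / 2 ≤ A.card := by
    have : (B.card : ℝ) + A.card = m := by exact_mod_cast hAB
    linarith
  let g : ℕ → ℝ := fun j => C * Metric.infDist (x j)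
    ((fun i : Fin n => x i) '' {l : Fin n | d l ≠ d j})
  have hg0 : ∀ j, 0 ≤ g j := fun j => mul_nonneg hC Metric.infDist_nonneg
  have hgA : ∀ j ∈ A, C * r ≤ g j := fun j hj => by
    obtain ⟨hjm, hj⟩ := Finset.mem_filter.1 hj
    have hjn : j < n := (Finset.mem_range.1 hjm).trans_le hmn
    refine mul_le_mul_of_nonneg_left ?_ hC
    obtain ⟨l, hl⟩ := hopp ⟨j, hjn⟩
    refine (Metric.le_infDist (Set.Nonempty.image _ ⟨l, hl⟩)).2 ?_
    rintro _ ⟨l', hl', rfl⟩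
    rw [dist_comm, dist_eq_norm]
    by_contra! hlt
    exact hj ⟨l', l'.2.trans_le hnm, fun e => hl' (by rw [e]), hlt.le⟩
  have hn0 : (0 : ℝ) < n := by exact_mod_cast hm.trans_le hmn
  have hsum : (m : ℝ) / 2 * (C * r) ≤ ∑ j : Fin n, g j := by
    rw [Fin.sum_univ_eq_sum_range]
    calc (m : ℝ) / 2 * (C * r) ≤ A.card * (C * r) := by gcongr
      _ = ∑ _j ∈ A, C * r := by rw [Finset.sum_const, nsmul_eq_mul]
      _ ≤ ∑ j ∈ A, g j := Finset.sum_le_sum hgA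
      _ ≤ ∑ j ∈ Finset.range n, g j := by
          refine Finset.sum_le_sum_of_subset_of_nonneg (fun j hj => ?_) fun j _ _ => hg0 j
          exact Finset.mem_range.2
            ((Finset.mem_range.1 (Finset.mem_filter.1 hj).1).trans_le hmn)
  have hnm' : (n : ℝ) ≤ 2 * m := by exact_mod_cast hnm
  change C * r / 4 ≤ 1 / (n : ℝ) * ∑ j : Fin n, g j
  rw [one_div, inv_mul_eq_div, le_div_iff₀ hn0]
  have : 0 ≤ C * r := mul_nonneg hC hr
  nlinarith

end FiniteSample

/-! ### Borel–Cantelli arguments -/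

section AlmostSure

variable {E : Type*} [NormedAddCommGroup E] [NormedSpace ℝ E] [FiniteDimensional ℝ E]
  [MeasurableSpace E] [BorelSpace E] {vol : Measure E} [vol.IsAddHaarMeasure]
  {Ω : Type*} [MeasurableSpace Ω] {μ : Measure Ω} [IsProbabilityMeasure μ]
  {X : ℕ → Ω → E} {D : ℕ → Ω → Bool}

lemma tsum_ofReal_ne_top_of_eventually_le {u : ℕ → ℝ≥0∞} {v : ℕ → ℝ} (hv : Summable v)
    (hv0 : ∀ n, 0 ≤ v n) (hu : ∀ n, u n ≠ ⊤) (h : ∀ᶠ n in atTop, u n ≤ ENNReal.ofReal (v n)) :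
    ∑' n, u n ≠ ⊤ := by
  have h2 : Summable fun n => (u n).toReal := by
    refine Summable.of_norm_bounded_eventually_nat hv ?_
    filter_upwards [h] with n hn
    rw [Real.norm_of_nonneg ENNReal.toReal_nonneg]
    exact ENNReal.toReal_le_of_le_ofReal (hv0 n) hn
  have h3 := h2.tsum_ofReal_ne_top
  simpa [ENNReal.ofReal_toReal (hu _)] using h3

/-- Exponential bounds with a logarithmic rate are summable. -/
lemma natCast_mul_exp_le {n : ℕ} (hn : 0 < n) {u : ℝ} (hu : 4 * Real.log n ≤ u) :
    (n : ℝ) * Real.exp (-u) ≤ 1 / (n : ℝ) ^ 2 := by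
  have hn0 : (0 : ℝ) < n := by exact_mod_cast hn
  have hn1 : (1 : ℝ) ≤ n := by exact_mod_cast hn
  have h1 : Real.exp (-u) ≤ ((n : ℝ) ^ 4)⁻¹ := by
    rw [Real.exp_neg]
    gcongr
    calc (n : ℝ) ^ 4 = Real.exp (4 * Real.log n) := by
          rw [mul_comm, Real.exp_mul, Real.exp_log hn0]; norm_cast
      _ ≤ _ := Real.exp_le_exp.2 hu
  calc (n : ℝ) * Real.exp (-u) ≤ n * ((n : ℝ) ^ 4)⁻¹ := by gcongr
    _ = 1 / (n : ℝ) ^ 2 * (1 / n) := by field_simp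
    _ ≤ 1 / (n : ℝ) ^ 2 * 1 := by
        gcongr
        rw [div_le_one hn0]; exact hn1
    _ = _ := mul_one _

lemma summable_one_div_sq (c : ℝ) : Summable fun n : ℕ => c * (1 / (n : ℝ) ^ 2) :=
  (Real.summable_one_div_nat_pow.2 one_lt_two).mul_left c

/-- Almost surely, all units eventually have close units of both treatments. -/
lemma ae_eventually_exists_close (hX : ∀ i, Measurable (X i)) (hD : ∀ i, Measurable (D i))
    (hindep : iIndepFun (fun (i : ℕ) (ω : Ω) => (X i ω, D i ω)) μ) {ν : Measure (E × Bool)}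
    [IsProbabilityMeasure ν] (hν : ∀ i, μ.map (fun ω => (X i ω, D i ω)) = ν) {a : ℕ → ℝ}
    (ha : ∀ᶠ n : ℕ in atTop, ∀ᵐ z ∂ν, ∀ b : Bool,
      8 * Real.log n / n ≤ ν.real {w : E × Bool | ‖w.1 - z.1‖ ≤ a n ∧ w.2 = b}) :
    ∀ᵐ ω ∂μ, ∀ᶠ n : ℕ in atTop, ∀ j < n, ∀ b : Bool,
      ∃ l < n, l ≠ j ∧ ‖X l ω - X j ω‖ ≤ a n ∧ D l ω = b := by
  let A : ℕ → Set Ω := fun n => {ω | ¬ ∀ j < n, ∀ b : Bool,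
      ∃ l < n, l ≠ j ∧ ‖X l ω - X j ω‖ ≤ a n ∧ D l ω = b}
  have hA : ∑' n, μ (A n) ≠ ⊤ := by
    refine tsum_ofReal_ne_top_of_eventually_le (summable_one_div_sq 2) (fun n => by positivity)
      (fun n => measure_ne_top _ _) ?_
    filter_upwards [ha, eventually_gt_atTop 1] with n han hn
    have hn1 : (1 : ℝ) < n := by exact_mod_cast hn
    have hlog := Real.log_pos hn1
    let R : Bool → Set ((E × Bool) × (E × Bool)) := fun b =>
      {q | ‖q.2.1 - q.1.1‖ ≤ a n ∧ q.2.2 = b}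
    have hR : ∀ b, MeasurableSet (R b) := fun b => by
      have h1 : MeasurableSet {q : (E × Bool) × (E × Bool) | ‖q.2.1 - q.1.1‖ ≤ a n} :=
        measurableSet_le (by fun_prop) (by fun_prop)
      exact h1.inter ((measurable_snd.comp measurable_snd) (measurableSet_singleton b))
    have hj : ∀ j < n, ∀ b, μ {ω | ∀ l ∈ (Finset.range n).erase j,
        ((X j ω, D j ω), (X l ω, D l ω)) ∉ R b} ≤
          ENNReal.ofReal (Real.exp (-(8 * Real.log n / n * (n - 1 : ℕ)))) := fun j hj b => by
      have := measure_forall_notMem_le (fun i => (hX i).prodMk (hD i)) hindep hν (hR b) (i := j)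
        (s := (Finset.range n).erase j) (Finset.notMem_erase _ _)
        (t := 8 * Real.log n / n) (by positivity) (by
          filter_upwards [han] with z hz
          exact ENNReal.ofReal_le_of_le_toReal (hz b))
      rwa [Finset.card_erase_of_mem (Finset.mem_range.2 hj), Finset.card_range] at this
    have hsub : A n ⊆ ⋃ j ∈ Finset.range n, ⋃ b ∈ (Finset.univ : Finset Bool),
        {ω | ∀ l ∈ (Finset.range n).erase j, ((X j ω, D j ω), (X l ω, D l ω)) ∉ R b} := by
      intro ω hω
      have hω : ¬ ∀ j < n, ∀ b : Bool,
        ∃ l < n, l ≠ j ∧ ‖X l ω - X j ω‖ ≤ a n ∧ D l ω = b := hω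
      push Not at hω
      obtain ⟨j, hj, b, hb⟩ := hω
      simp only [Set.mem_iUnion]
      refine ⟨j, Finset.mem_range.2 hj, b, Finset.mem_univ b, fun l hl hmem => ?_⟩
      obtain ⟨hlj, hln⟩ := Finset.mem_erase.1 hl
      exact hb l (Finset.mem_range.1 hln) hlj hmem.1 hmem.2
    -- The unit itself is excluded; `n - 1 ≥ n / 2` turns the constant `8` into `4`, enough to
    -- survive the union over units and arms.
    have hexp : 4 * Real.log n ≤ 8 * Real.log n / n * (n - 1 : ℕ) := by
      rw [Nat.cast_sub hn.le, Nat.cast_one, div_mul_eq_mul_div, le_div_iff₀ (by linarith)]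
      have hn2 : (2 : ℝ) ≤ n := by exact_mod_cast hn
      nlinarith
    calc μ (A n) ≤ ∑ _j ∈ Finset.range n, ∑ _b ∈ (Finset.univ : Finset Bool),
          ENNReal.ofReal (Real.exp (-(8 * Real.log n / n * (n - 1 : ℕ)))) :=
          (measure_mono hsub).trans ((measure_biUnion_finset_le _ _).trans
            (Finset.sum_le_sum fun j hj' => (measure_biUnion_finset_le _ _).trans
              (Finset.sum_le_sum fun b _ => hj j (Finset.mem_range.1 hj') b)))
      _ = ENNReal.ofReal (2 * (n * Real.exp (-(8 * Real.log n / n * (n - 1 : ℕ))))) := by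
          rw [Finset.sum_const, Finset.sum_const, Finset.card_range, Finset.card_univ,
            Fintype.card_bool, nsmul_eq_mul, nsmul_eq_mul, ENNReal.ofReal_mul two_pos.le,
            ENNReal.ofReal_mul (by positivity), ENNReal.ofReal_natCast]
          push_cast
          rw [ENNReal.ofReal_ofNat]
          ring
      _ ≤ _ := by
          gcongr
          exact natCast_mul_exp_le (by omega) hexp
  filter_upwards [ae_eventually_notMem hA] with ω hω
  filter_upwards [hω] with n hn
  exact not_not.1 hn

open Classical in
/-- Almost surely, no unit eventually has too many units nearby. -/
lemma ae_eventually_card_close_le (hX : ∀ i, Measurable (X i)) (hD : ∀ i, Measurable (D i))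
    (hindep : iIndepFun (fun (i : ℕ) (ω : Ω) => (X i ω, D i ω)) μ) {ν : Measure (E × Bool)}
    [IsProbabilityMeasure ν] (hν : ∀ i, μ.map (fun ω => (X i ω, D i ω)) = ν) {a G : ℕ → ℝ}
    (hG0 : ∀ᶠ n : ℕ in atTop, 8 * Real.log n / n ≤ G n)
    (hG : ∀ᶠ n : ℕ in atTop, ∀ᵐ z ∂ν, ∀ b : Bool,
      ν.real {w : E × Bool | ‖w.1 - z.1‖ ≤ a n ∧ w.2 = b} ≤ G n) :
    ∀ᵐ ω ∂μ, ∀ᶠ n : ℕ in atTop, ∀ i < n,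
      ((((Finset.range n).erase i).filter fun l => ‖X l ω - X i ω‖ ≤ a n).card : ℝ) ≤
        8 * (n * G n) := by
  let A : ℕ → Set Ω := fun n => {ω | ¬ ∀ i < n,
      ((((Finset.range n).erase i).filter fun l => ‖X l ω - X i ω‖ ≤ a n).card : ℝ) ≤
        8 * (n * G n)}
  have hA : ∑' n, μ (A n) ≠ ⊤ := by
    refine tsum_ofReal_ne_top_of_eventually_le (summable_one_div_sq 1) (fun n => by positivity)
      (fun n => measure_ne_top _ _) ?_
    filter_upwards [hG0, hG, eventually_gt_atTop 1] with n hG0n hGn hn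
    have hn1 : (1 : ℝ) < n := by exact_mod_cast hn
    have hlog := Real.log_pos hn1
    have hGpos : 0 ≤ G n := le_trans (by positivity) hG0n
    let R : Set ((E × Bool) × (E × Bool)) := {q | ‖q.2.1 - q.1.1‖ ≤ a n}
    have hR : MeasurableSet R := measurableSet_le (by fun_prop) (by fun_prop)
    -- Both arms count as neighbours, hence `2 * G n` here and the final constant `8 = 4 * 2`.
    have hmass : ∀ᵐ z ∂ν, ν {w | (z, w) ∈ R} ≤ ENNReal.ofReal (2 * G n) := by
      filter_upwards [hGn] with z hz
      have hb : ∀ b, ν {w : E × Bool | ‖w.1 - z.1‖ ≤ a n ∧ w.2 = b} ≤ ENNReal.ofReal (G n) :=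
        fun b => (ENNReal.le_ofReal_iff_toReal_le (measure_ne_top _ _) hGpos).2 (hz b)
      calc ν {w | (z, w) ∈ R} ≤ ν ({w : E × Bool | ‖w.1 - z.1‖ ≤ a n ∧ w.2 = true} ∪
            {w : E × Bool | ‖w.1 - z.1‖ ≤ a n ∧ w.2 = false}) := measure_mono fun w hw => by
              cases h : w.2
              · exact Or.inr ⟨hw, h⟩
              · exact Or.inl ⟨hw, h⟩
        _ ≤ ENNReal.ofReal (G n) + ENNReal.ofReal (G n) :=
            (measure_union_le _ _).trans (add_le_add (hb true) (hb false))
        _ = _ := by rw [← ENNReal.ofReal_add hGpos hGpos, two_mul]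
    have hi : ∀ i < n, μ {ω | 4 * (n * (2 * G n)) ≤ ((((Finset.range n).erase i).filter fun l =>
        ((X i ω, D i ω), (X l ω, D l ω)) ∈ R).card : ℝ)} ≤
          ENNReal.ofReal (Real.exp (-(2 * (n * (2 * G n))))) := fun i hi => by
      refine measure_le_card_le (fun i => (hX i).prodMk (hD i)) hindep hν hR (i := i)
        (s := (Finset.range n).erase i) (Finset.notMem_erase _ _) (by positivity) hmass ?_
      exact_mod_cast (Finset.card_erase_le).trans_eq (Finset.card_range n)
    have hsub : A n ⊆ ⋃ i ∈ Finset.range n,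
        {ω | 4 * (n * (2 * G n)) ≤ ((((Finset.range n).erase i).filter fun l =>
          ((X i ω, D i ω), (X l ω, D l ω)) ∈ R).card : ℝ)} := by
      intro ω hω
      have hω : ¬ ∀ i < n,
        ((((Finset.range n).erase i).filter fun l => ‖X l ω - X i ω‖ ≤ a n).card : ℝ) ≤
        8 * (n * G n) := hω
      push Not at hω
      obtain ⟨i, hi, hlt⟩ := hω
      simp only [Set.mem_iUnion]
      refine ⟨i, Finset.mem_range.2 hi, ?_⟩
      refine le_trans (by linarith) hlt.le
    have hexp : 4 * Real.log n ≤ 2 * (n * (2 * G n)) := by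
      rw [div_le_iff₀ (by linarith)] at hG0n
      linarith
    calc μ (A n) ≤ ∑ _i ∈ Finset.range n, ENNReal.ofReal (Real.exp (-(2 * (n * (2 * G n))))) :=
          (measure_mono hsub).trans ((measure_biUnion_finset_le _ _).trans
            (Finset.sum_le_sum fun i hi' => hi i (Finset.mem_range.1 hi')))
      _ = ENNReal.ofReal (1 * (n * Real.exp (-(2 * (n * (2 * G n)))))) := by
          rw [Finset.sum_const, Finset.card_range, nsmul_eq_mul, one_mul,
            ENNReal.ofReal_mul (by positivity), ENNReal.ofReal_natCast]
      _ ≤ _ := by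
          gcongr
          exact natCast_mul_exp_le (by omega) hexp
  filter_upwards [ae_eventually_notMem hA] with ω hω
  filter_upwards [hω] with n hn
  exact not_not.1 hn

open Classical in
/-- Almost surely, at least half of the first `2 ^ k` units are eventually isolated. -/
lemma ae_eventually_card_not_isolated_le [Nontrivial E] (hX : ∀ i, Measurable (X i))
    (hindep : iIndepFun X μ) {K : ℝ≥0}
    (hK : ∀ i B, MeasurableSet B → μ (X i ⁻¹' B) ≤ K * vol B) :
    ∀ᵐ ω ∂μ, ∀ᶠ k : ℕ in atTop,
      (((Finset.range (2 ^ k)).filter fun j => ∃ l < 2 * 2 ^ k, l ≠ j ∧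
        ‖X l ω - X j ω‖ ≤ ((2 : ℝ) ^ k) ^ (-(9 / (8 * (Module.finrank ℝ E : ℝ))))).card : ℝ) ≤
          ((2 ^ k : ℕ) : ℝ) / 2 := by
  set p : ℝ := (Module.finrank ℝ E : ℝ) with hp
  have hp0 : 0 < p := by
    rw [hp]; exact_mod_cast Module.finrank_pos
  set r : ℕ → ℝ := fun k => ((2 : ℝ) ^ k) ^ (-(9 / (8 * p))) with hr
  have hr0 : ∀ k, 0 ≤ r k := fun k => by positivity
  set V : ℝ := K * vol.real (Metric.ball (0 : E) 1) with hV
  have hV0 : 0 ≤ V := by positivity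
  let N : ℕ → Ω → ℕ := fun k ω => ((Finset.range (2 ^ k)).filter fun j =>
    ∃ l < 2 * 2 ^ k, l ≠ j ∧ ‖X l ω - X j ω‖ ≤ r k).card
  let A : ℕ → Set Ω := fun k => {ω | ¬ (N k ω : ℝ) ≤ ((2 ^ k : ℕ) : ℝ) / 2}
  have hpair : ∀ k, ∀ j l : ℕ, l ≠ j → μ {ω | ‖X l ω - X j ω‖ ≤ r k} ≤
      ENNReal.ofReal (V * ((2 : ℝ) ^ k) ^ (-(9 / 8) : ℝ)) := fun k j l hlj => by
    refine (measure_norm_sub_le hX hindep hK hlj.symm (hr0 k)).trans_eq ?_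
    have h1 : r k ^ Module.finrank ℝ E = ((2 : ℝ) ^ k) ^ (-(9 / 8) : ℝ) := by
      rw [hr, ← Real.rpow_natCast, ← Real.rpow_mul (by positivity), ← hp]
      congr 1
      field_simp
    rw [h1, hV, ENNReal.ofReal_mul (by positivity), ENNReal.ofReal_mul (by positivity),
      ENNReal.ofReal_coe_nnreal, ofReal_measureReal measure_ball_lt_top.ne]
    ring
  -- There are at most `2 m ^ 2` ordered pairs, each close with probability at most `V * m ^
  -- (-9/8)`. Markov's inequality at level `m / 2` leaves `4 V m ^ (-1/8)`, which is summable along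
  -- `m = 2 ^ k`.
  have hA : ∑' k, μ (A k) ≠ ⊤ := by
    have hgeom : Summable fun k : ℕ => 4 * V * ((2 : ℝ) ^ (-(1 / 8) : ℝ)) ^ k :=
      (summable_geometric_of_lt_one (by positivity)
        (Real.rpow_lt_one_of_one_lt_of_neg one_lt_two (by norm_num))).mul_left _
    refine tsum_ofReal_ne_top_of_eventually_le hgeom (fun n => by positivity)
      (fun n => measure_ne_top _ _) (Eventually.of_forall fun k => ?_)
    set m : ℕ := 2 ^ k with hm
    have hm0 : (0 : ℝ) < m := by rw [hm]; positivity
    let T : ℕ → ℕ → Set Ω := fun j l => {ω | ‖X l ω - X j ω‖ ≤ r k}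
    have hT : ∀ j l, MeasurableSet (T j l) := fun j l =>
      measurableSet_le (((hX l).sub (hX j)).norm) measurable_const
    let Q : Ω → ℝ≥0∞ := fun ω => ∑ j ∈ Finset.range m, ∑ l ∈ (Finset.range (2 * m)).erase j,
      (T j l).indicator 1 ω
    have hQm : Measurable Q := Finset.measurable_sum _ fun j _ => Finset.measurable_sum _ fun l _ =>
      measurable_one.indicator (hT j l)
    have hNQ : ∀ ω, (N k ω : ℝ≥0∞) ≤ Q ω := fun ω => by
      simp only [N, Finset.card_filter, Nat.cast_sum, Q]
      refine Finset.sum_le_sum fun j _ => ?_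
      split_ifs with hex
      · obtain ⟨l, hl, hlj, hle⟩ := hex
        have hmem : l ∈ (Finset.range (2 * m)).erase j :=
          Finset.mem_erase.2 ⟨hlj, Finset.mem_range.2 hl⟩
        refine le_trans ?_ (Finset.single_le_sum
          (f := fun l => (T j l).indicator (1 : Ω → ℝ≥0∞) ω) (fun _ _ => zero_le) hmem)
        simp only [Set.indicator_of_mem (show ω ∈ T j l from hle)]
        simp
      · simp
    have hQint : ∫⁻ ω, Q ω ∂μ ≤
        ENNReal.ofReal (m * (2 * m * (V * ((2 : ℝ) ^ k) ^ (-(9 / 8) : ℝ)))) := by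
      simp only [Q]
      rw [lintegral_finsetSum _ fun j _ => Finset.measurable_sum _ fun l _ =>
        measurable_one.indicator (hT j l)]
      calc _ ≤ ∑ _j ∈ Finset.range m, ENNReal.ofReal
            (2 * m * (V * ((2 : ℝ) ^ k) ^ (-(9 / 8) : ℝ))) := by
            refine Finset.sum_le_sum fun j _ => ?_
            rw [lintegral_finsetSum _ fun l _ => measurable_one.indicator (hT j l)]
            calc _ ≤ ∑ _l ∈ (Finset.range (2 * m)).erase j,
                  ENNReal.ofReal (V * ((2 : ℝ) ^ k) ^ (-(9 / 8) : ℝ)) := by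
                  refine Finset.sum_le_sum fun l hl => ?_
                  rw [lintegral_indicator_one (hT j l)]
                  exact hpair k j l (Finset.mem_erase.1 hl).1
              _ ≤ _ := by
                  rw [Finset.sum_const, nsmul_eq_mul,
                    ENNReal.ofReal_mul (p := 2 * (m : ℝ)) (by positivity)]
                  refine mul_le_mul_left ?_ _
                  have : (2 : ℝ) * m = ((2 * m : ℕ) : ℝ) := by push_cast; ring
                  rw [this, ENNReal.ofReal_natCast]
                  exact_mod_cast (Finset.card_erase_le).trans_eq (Finset.card_range _)
        _ = _ := by
            rw [Finset.sum_const, Finset.card_range, nsmul_eq_mul,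
              ENNReal.ofReal_mul hm0.le, ENNReal.ofReal_natCast]
    have hmark := meas_ge_le_lintegral_div (μ := μ) (f := Q) (ε := ENNReal.ofReal (m / 2))
      hQm.aemeasurable (by simp; positivity) ENNReal.ofReal_ne_top
    calc μ (A k) ≤ μ {ω | ENNReal.ofReal (m / 2) ≤ Q ω} := by
          refine measure_mono fun ω hω => ?_
          have hω : ¬ (N k ω : ℝ) ≤ (m : ℝ) / 2 := hω
          refine le_trans ?_ (hNQ ω)
          rw [← ENNReal.ofReal_natCast]
          exact ENNReal.ofReal_le_ofReal (not_le.1 hω).le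
      _ ≤ _ := hmark
      _ ≤ ENNReal.ofReal (m * (2 * m * (V * ((2 : ℝ) ^ k) ^ (-(9 / 8) : ℝ)))) /
            ENNReal.ofReal (m / 2) := by gcongr
      _ = ENNReal.ofReal (4 * V * ((2 : ℝ) ^ (-(1 / 8) : ℝ)) ^ k) := by
          rw [← ENNReal.ofReal_div_of_pos (by positivity)]
          congr 1
          have hmk : (m : ℝ) = (2 : ℝ) ^ k := by rw [hm]; push_cast; rfl
          have h2 : ((2 : ℝ) ^ k) ^ (-(9 / 8) : ℝ) * (2 : ℝ) ^ k =
              ((2 : ℝ) ^ (-(1 / 8) : ℝ)) ^ k := by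
            rw [← Real.rpow_add_one (by positivity), ← Real.rpow_natCast, ← Real.rpow_mul two_pos.le,
              ← Real.rpow_natCast, ← Real.rpow_mul two_pos.le]
            congr 1
            ring
          rw [← h2, ← hmk]
          field_simp
          ring
  filter_upwards [ae_eventually_notMem hA] with ω hω
  filter_upwards [hω] with n hn
  exact not_not.1 hn

end AlmostSure

/-! ### Comparing standard deviation and bias -/

section Dominance

variable {E : Type*} [NormedAddCommGroup E] {C : ℝ} {σ2 : E → Bool → ℝ≥0} {hi : ℝ≥0} {x : ℕ → E}
  {d : ℕ → Bool} {a G : ℕ → ℝ} {p : ℝ}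

lemma tendsto_log_two_atTop : Tendsto (Nat.log 2) atTop atTop :=
  tendsto_atTop.2 fun b => (eventually_ge_atTop (2 ^ b)).mono fun _ hn =>
    Nat.le_log_of_pow_le one_lt_two hn

open Classical in
-- For `2 ^ k ≤ n < 2 ^ (k + 1)`, isolation of the first `2 ^ k` points among the first `2 * 2 ^ k`
-- covers the whole sample. The radius at `2 ^ k` is at least the one at `n`, as the exponent is
-- negative.
lemma eventually_matchBias_ge (hC : 0 ≤ C) (hp : 0 < p)
    (hopp : ∀ᶠ n : ℕ in atTop, ∀ j : Fin n, ∃ l : Fin n, d l ≠ d j)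
    (hiso : ∀ᶠ k : ℕ in atTop,
      (((Finset.range (2 ^ k)).filter fun j => ∃ l < 2 * 2 ^ k, l ≠ j ∧
        ‖x l - x j‖ ≤ ((2 : ℝ) ^ k) ^ (-(9 / (8 * p)))).card : ℝ) ≤ ((2 ^ k : ℕ) : ℝ) / 2) :
    ∀ᶠ n : ℕ in atTop, C / 4 * (n : ℝ) ^ (-(9 / (8 * p))) ≤
      matchBias C (fun i : Fin n => x i) (fun i => d i) := by
  filter_upwards [hopp, tendsto_log_two_atTop.eventually hiso, eventually_gt_atTop 0]
    with n hn hk hn0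
  have h1 : 2 ^ Nat.log 2 n ≤ n := Nat.pow_log_le_self 2 hn0.ne'
  have h2 : n ≤ 2 * 2 ^ Nat.log 2 n := by
    have := Nat.lt_pow_succ_log_self one_lt_two n
    rw [pow_succ] at this
    omega
  refine le_trans ?_ (matchBias_ge_of_isolated hC (by positivity) (by positivity) h1 h2 hn hk)
  rw [div_mul_eq_mul_div]
  have h3 : (n : ℝ) ^ (-(9 / (8 * p))) ≤ ((2 : ℝ) ^ Nat.log 2 n) ^ (-(9 / (8 * p))) :=
    Real.rpow_le_rpow_of_nonpos (by positivity) (by exact_mod_cast h1)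
      (neg_nonpos.2 (by positivity))
  gcongr

open Classical in
lemma eventually_sd_sq_match_le (hσ : ∀ z b, σ2 z b ≤ hi)
    (hties : ∀ i l j : ℕ, i ≠ l → d j ≠ d i → ‖x l - x j‖ ≠ ‖x i - x j‖)
    (hG0 : ∀ᶠ n : ℕ in atTop, 8 * Real.log n / n ≤ G n)
    (hclose : ∀ᶠ n : ℕ in atTop, ∀ j < n, ∀ b : Bool,
      ∃ l < n, l ≠ j ∧ ‖x l - x j‖ ≤ a n ∧ d l = b)
    (hcard : ∀ᶠ n : ℕ in atTop, ∀ i < n,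
      ((((Finset.range n).erase i).filter fun l => ‖x l - x i‖ ≤ a n).card : ℝ) ≤
        8 * (n * G n)) :
    ∀ᶠ n : ℕ in atTop, sd σ2 (fun i : Fin n => x i) (fun i => d i)
      (matchWeight 1 (fun i : Fin n => x i) (fun i => d i)) ^ 2 ≤ 18 * hi * G n := by
  filter_upwards [hG0, hclose, hcard, eventually_gt_atTop 1] with n hG0 hclose hcard hn
  have hn0 : (0 : ℝ) < n := by positivity
  have hn2 : (2 : ℝ) ≤ n := by exact_mod_cast hn
  -- This absorbs the `1` in `1 + matchCount ≤ 1 + 8nG ≤ 9nG`; doubling gives the constant `18`.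
  have hnG : 1 ≤ n * G n := by
    rw [div_le_iff₀ hn0] at hG0
    have := Real.log_le_log two_pos hn2
    linarith [Real.log_two_gt_d9]
  have hopp : ∀ j : Fin n, ∃ l : Fin n, d l ≠ d j := fun j => by
    obtain ⟨l, hl, -, -, hdl⟩ := hclose j j.2 (!d j)
    exact ⟨⟨l, hl⟩, by simp [hdl]⟩
  have h := sd_sq_match_le (x := fun i : Fin n => x i) (d := fun i => d i) hσ hopp
    (fun i l j hil hd => hties i l j (fun e => hil (Fin.ext e)) hd) (κ := 9 * (n * G n))
    (fun i => by
      have h1 : (matchCount 1 (fun i : Fin n => x i) (fun i => d i) i : ℝ) ≤ _ :=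
        Nat.cast_le.2 (matchCount_le_of_close hclose i)
      have h2 := hcard i i.2
      linarith)
  refine h.trans_eq ?_
  field_simp
  ring

open Classical in
-- The squared bias is at least `(C/4)² n ^ (-9/(4p))` and the variance at most `18 * hi * G n`, so
-- the squared ratio is bounded by a constant times the sequence in `hlim`.
lemma biasDominates_of_eventually (hC : 0 < C) (hp : 0 < p) (hσ : ∀ z b, σ2 z b ≤ hi)
    (hties : ∀ i l j : ℕ, i ≠ l → d j ≠ d i → ‖x l - x j‖ ≠ ‖x i - x j‖)
    (hG0 : ∀ᶠ n : ℕ in atTop, 8 * Real.log n / n ≤ G n)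
    (hclose : ∀ᶠ n : ℕ in atTop, ∀ j < n, ∀ b : Bool,
      ∃ l < n, l ≠ j ∧ ‖x l - x j‖ ≤ a n ∧ d l = b)
    (hcard : ∀ᶠ n : ℕ in atTop, ∀ i < n,
      ((((Finset.range n).erase i).filter fun l => ‖x l - x i‖ ≤ a n).card : ℝ) ≤
        8 * (n * G n))
    (hiso : ∀ᶠ k : ℕ in atTop,
      (((Finset.range (2 ^ k)).filter fun j => ∃ l < 2 * 2 ^ k, l ≠ j ∧
        ‖x l - x j‖ ≤ ((2 : ℝ) ^ k) ^ (-(9 / (8 * p)))).card : ℝ) ≤ ((2 ^ k : ℕ) : ℝ) / 2)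
    (hlim : Tendsto (fun n : ℕ => G n * (n : ℝ) ^ (9 / (4 * p))) atTop (𝓝 0)) :
    BiasDominates C σ2 x d := by
  have hopp : ∀ᶠ n : ℕ in atTop, ∀ j : Fin n, ∃ l : Fin n, d l ≠ d j := by
    filter_upwards [hclose] with n hclose j
    obtain ⟨l, hl, -, -, hdl⟩ := hclose j j.2 (!d j)
    exact ⟨⟨l, hl⟩, by simp [hdl]⟩
  have hbias := eventually_matchBias_ge hC.le hp hopp hiso
  have hsd := eventually_sd_sq_match_le hσ hties hG0 hclose hcard
  refine ⟨hopp, hties, ?_, ?_⟩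
  · filter_upwards [hbias, eventually_gt_atTop 0] with n h hn
    have : (0 : ℝ) < n := by exact_mod_cast hn
    exact lt_of_lt_of_le (by positivity) h
  · set q : ℕ → ℝ := fun n => sd σ2 (fun i : Fin n => x i) (fun i => d i)
      (matchWeight 1 (fun i : Fin n => x i) (fun i => d i)) /
        matchBias C (fun i : Fin n => x i) (fun i => d i) with hq
    have hq0 : ∀ n, 0 ≤ q n := fun n => div_nonneg (sd_nonneg _ _ _ _) (matchBias_nonneg hC.le _ _)
    have hbound : ∀ᶠ n : ℕ in atTop,
        q n ^ 2 ≤ 18 * hi / (C / 4) ^ 2 * (G n * (n : ℝ) ^ (9 / (4 * p))) := by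
      filter_upwards [hbias, hsd, eventually_gt_atTop 0] with n hb hs hn
      have hn0 : (0 : ℝ) < n := by exact_mod_cast hn
      have hpow : ((n : ℝ) ^ (-(9 / (8 * p)))) ^ 2 * (n : ℝ) ^ (9 / (4 * p)) = 1 := by
        rw [← Real.rpow_natCast, ← Real.rpow_mul hn0.le, ← Real.rpow_add hn0]
        have : -(9 / (8 * p)) * ((2 : ℕ) : ℝ) + 9 / (4 * p) = 0 := by
          push_cast; field_simp; ring
        rw [this, Real.rpow_zero]
      have hpos : 0 < C / 4 * (n : ℝ) ^ (-(9 / (8 * p))) := by positivity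
      have hG : 0 ≤ 18 * hi * G n := (sq_nonneg _).trans hs
      calc q n ^ 2 ≤ 18 * hi * G n / (C / 4 * (n : ℝ) ^ (-(9 / (8 * p)))) ^ 2 := by
            rw [hq, div_pow]
            gcongr
        _ = 18 * hi / (C / 4) ^ 2 * (G n * (n : ℝ) ^ (9 / (4 * p))) := by
            rw [mul_pow, div_eq_iff (by positivity)]
            calc 18 * hi * G n = 18 * hi * G n * 1 := (mul_one _).symm
              _ = _ := by
                  rw [← hpow]
                  field_simp
    have hsq : Tendsto (fun n => q n ^ 2) atTop (𝓝 0) :=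
      tendsto_of_tendsto_of_tendsto_of_le_of_le' tendsto_const_nhds
        (by simpa using hlim.const_mul (18 * hi / (C / 4) ^ 2))
        (Eventually.of_forall fun n => sq_nonneg _) hbound
    have := hsq.sqrt
    rw [Real.sqrt_zero] at this
    exact this.congr fun n => Real.sqrt_sq (hq0 n)

end Dominance

/-! ### Almost sure dominance of the bias and the theorem -/

lemma ae_biasDominates {E : Type*} [NormedAddCommGroup E] [NormedSpace ℝ E]
    [FiniteDimensional ℝ E] [Nontrivial E] [MeasurableSpace E] [BorelSpace E] {vol : Measure E}
    [vol.IsAddHaarMeasure] {Ω : Type*} [MeasurableSpace Ω] {μ : Measure Ω} [IsProbabilityMeasure μ]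
    {X : ℕ → Ω → E} {D : ℕ → Ω → Bool} (hX : ∀ i, Measurable (X i)) (hD : ∀ i, Measurable (D i))
    (hindep : iIndepFun (fun (i : ℕ) (ω : Ω) => (X i ω, D i ω)) μ)
    (hident : ∀ i, IdentDistrib (fun ω => (X i ω, D i ω)) (fun ω => (X 0 ω, D 0 ω)) μ μ)
    (hdens : ∀ d : Bool, HasBoundedDensity vol ((μ[|{ω | D 0 ω = d}]).map (X 0)))
    {σ2 : E → Bool → ℝ≥0} {hi : ℝ≥0} (hσ : ∀ x d, σ2 x d ≤ hi)
    {S : Set E} (hS : ∀ᵐ ω ∂μ, X 0 ω ∈ S)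
    {Glow Gup : ℝ → ℝ} (hGlow : ∀ a, 0 < a → 0 < Glow a)
    (hG : ∀ᶠ a in 𝓝[>] (0 : ℝ), ∀ x ∈ S, ∀ d : Bool,
      Glow a ≤ μ.real {ω | ‖X 0 ω - x‖ ≤ a ∧ D 0 ω = d} ∧
        μ.real {ω | ‖X 0 ω - x‖ ≤ a ∧ D 0 ω = d} ≤ Gup a)
    (hoverlap : Tendsto
      (fun t : ℝ => Gup (genInv Glow t) ^ 2 /
        (t / Real.log t⁻¹) ^ (2 / (Module.finrank ℝ E : ℝ) + 1))
      (𝓝[>] 0) (𝓝 0))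
    {C : ℝ} (hC : 0 < C) :
    ∀ᵐ ω ∂μ, BiasDominates C σ2 (fun i => X i ω) (fun i => D i ω) := by
  classical
  have hZ : ∀ i, Measurable fun ω => (X i ω, D i ω) := fun i => (hX i).prodMk (hD i)
  set ν : Measure (E × Bool) := μ.map fun ω => (X 0 ω, D 0 ω) with hνdef
  have : IsProbabilityMeasure ν := Measure.isProbabilityMeasure_map (hZ 0).aemeasurable
  have hν : ∀ i, μ.map (fun ω => (X i ω, D i ω)) = ν := fun i => (hident i).map_eq
  have hXindep : iIndepFun X μ := hindep.comp (fun _ => Prod.fst) fun _ => measurable_fst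
  obtain ⟨K, hK0⟩ := exists_measure_preimage_le (hX 0) (hD 0) hdens
  have hpre : ∀ i B, MeasurableSet B → ν (Prod.fst ⁻¹' B) = μ (X i ⁻¹' B) := fun i B hB => by
    rw [← hν i, Measure.map_apply (hZ i) (measurable_fst hB)]
    rfl
  have hKν : ∀ B, MeasurableSet B → ν (Prod.fst ⁻¹' B) ≤ K * vol B := fun B hB =>
    (hpre 0 B hB).trans_le (hK0 B hB)
  have hK : ∀ i B, MeasurableSet B → μ (X i ⁻¹' B) ≤ K * vol B := fun i B hB =>
    (hpre i B hB).symm.trans_le (hKν B hB)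
  have hmass : ∀ (x : E) (a : ℝ) (d : Bool), μ.real {ω | ‖X 0 ω - x‖ ≤ a ∧ D 0 ω = d} =
      ν.real {w : E × Bool | ‖w.1 - x‖ ≤ a ∧ w.2 = d} := fun x a d => by
    rw [measureReal_def, measureReal_def, hνdef,
      Measure.map_apply (hZ 0) (measurableSet_norm_sub_le_and x a d)]
    rfl
  simp_rw [hmass] at hG
  have hSν : ∀ᵐ z ∂ν, z.1 ∈ closure S := by
    rw [hνdef, ae_map_iff (hZ 0).aemeasurable (measurable_fst isClosed_closure.measurableSet)]
    exact hS.mono fun ω hω => subset_closure hω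
  have hSne : S.Nonempty := hS.exists.imp' (X 0) fun _ h => h
  have hM := eventually_mass_genInv hKν hSne hGlow hG
  -- The two bounds enclose the same ball mass, at any one point of `S`.
  have hF : ∀ᶠ t in 𝓝[>] (0 : ℝ), t ≤ Gup (genInv Glow t) := by
    obtain ⟨x, hx⟩ := hSne
    filter_upwards [hM] with t ht
    have := ht x (subset_closure hx) true
    exact this.1.trans this.2
  have hdim : 0 < Module.finrank ℝ E := Module.finrank_pos
  have hlim := tendsto_mul_rpow_of_overlap (F := fun t => Gup (genInv Glow t))
    (three_le_of_overlap hdim hF hoverlap) hoverlap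
  have hT := tendsto_log_div_nhdsGT 8 (by norm_num)
  have hMn := hT.eventually hM
  have hclose := ae_eventually_exists_close hX hD hindep hν
    (a := fun n => genInv Glow (8 * Real.log n / n))
    (hMn.mono fun n hn => hSν.mono fun z hz b => (hn z.1 hz b).1)
  have hcard := ae_eventually_card_close_le hX hD hindep hν
    (a := fun n => genInv Glow (8 * Real.log n / n))
    (G := fun n => Gup (genInv Glow (8 * Real.log n / n))) (hT.eventually hF)
    (hMn.mono fun n hn => hSν.mono fun z hz b => (hn z.1 hz b).2)
  filter_upwards [hclose, hcard, ae_no_ties hX hXindep hK,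
    ae_eventually_card_not_isolated_le hX hXindep hK] with ω h1 h2 h3 h4
  exact biasDominates_of_eventually hC (by exact_mod_cast hdim) hσ
    (fun i l j hil hd => h3 i l j hil fun h => hd (by rw [h])) (hT.eventually hF) h1 h2 h4 hlim

end CATE

theorem mainTheorem7
    -- `E` is `ℝ^{d_x}` with an arbitrary norm and `vol` is Lebesgue measure
    {E : Type*} [NormedAddCommGroup E] [NormedSpace ℝ E] [FiniteDimensional ℝ E] [Nontrivial E]
    [MeasurableSpace E] [BorelSpace E] (vol : Measure E) [vol.IsAddHaarMeasure]
    {Ω : Type*} [MeasurableSpace Ω] (μ : Measure Ω) [IsProbabilityMeasure μ]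
    -- the i.i.d. covariates and treatments
    (X : ℕ → Ω → E) (D : ℕ → Ω → Bool)
    (hX : ∀ i, Measurable (X i)) (hD : ∀ i, Measurable (D i))
    (hindep : iIndepFun (fun (i : ℕ) (ω : Ω) => (X i ω, D i ω)) μ)
    (hident : ∀ i, IdentDistrib (fun ω => (X i ω, D i ω)) (fun ω => (X 0 ω, D 0 ω)) μ μ)
    (hD0 : μ {ω | D 0 ω = true} ≠ 0) (hD1 : μ {ω | D 0 ω = true} ≠ 1)
    (hdens : ∀ d : Bool,
      CATE.HasBoundedDensity vol ((μ[|{ω | D 0 ω = d}]).map (X 0)))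
    -- the variance function
    (σ2 : E → Bool → ℝ≥0)
    (hσ : ∃ lo hi : ℝ≥0, 0 < lo ∧ ∀ x d, lo ≤ σ2 x d ∧ σ2 x d ≤ hi)
    -- the overlap condition
    (S : Set E) (hS : ∀ᵐ ω ∂μ, X 0 ω ∈ S)
    (Glow Gup : ℝ → ℝ) (hGlow : ∀ a, 0 < a → 0 < Glow a)
    (hG : ∀ᶠ a in 𝓝[>] (0 : ℝ), ∀ x ∈ S, ∀ d : Bool,
      Glow a ≤ μ.real {ω | ‖X 0 ω - x‖ ≤ a ∧ D 0 ω = d} ∧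
        μ.real {ω | ‖X 0 ω - x‖ ≤ a ∧ D 0 ω = d} ≤ Gup a)
    (hoverlap : Tendsto
      (fun t : ℝ => Gup (CATE.genInv Glow t) ^ 2 /
        (t / Real.log t⁻¹) ^ (2 / (Module.finrank ℝ E : ℝ) + 1))
      (𝓝[>] 0) (𝓝 0))
    (C : ℝ) (hC : 0 < C) :
    -- mean squared error
    (∀ᵐ ω ∂μ, Tendsto
      (fun n : ℕ =>
        CATE.worstMSE C σ2 (fun i : Fin n => X i ω) (fun i => D i ω)
            (CATE.matchWeight 1 (fun i : Fin n => X i ω) (fun i => D i ω)) /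
          ⨅ k : Fin n → ℝ,
            CATE.worstMSE C σ2 (fun i : Fin n => X i ω) (fun i => D i ω) k)
      atTop (𝓝 1)) ∧
    -- length of the fixed-length confidence interval
    (∀ α : ℝ, 0 < α → α ≤ 1 / 2 → ∀ᵐ ω ∂μ, Tendsto
      (fun n : ℕ =>
        CATE.flciLength α C σ2 (fun i : Fin n => X i ω) (fun i => D i ω)
            (CATE.matchWeight 1 (fun i : Fin n => X i ω) (fun i => D i ω)) /
          ⨅ k : Fin n → ℝ,
            CATE.flciLength α C σ2 (fun i : Fin n => X i ω) (fun i => D i ω) k)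
      atTop (𝓝 1)) ∧
    -- quantile of the excess length of the one-sided confidence interval
    (∀ α β : ℝ, 0 < α → α ≤ β → β < 1 → ∀ᵐ ω ∂μ, Tendsto
      (fun n : ℕ =>
        CATE.worstExcess α β C σ2 (fun i : Fin n => X i ω) (fun i => D i ω)
            (CATE.matchWeight 1 (fun i : Fin n => X i ω) (fun i => D i ω)) /
          ⨅ k : Fin n → ℝ,
            CATE.worstExcess α β C σ2 (fun i : Fin n => X i ω) (fun i => D i ω) k)
      atTop (𝓝 1)) := by
  obtain ⟨lo, hi, hlo, hσ⟩ := hσ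
  have hpos : ∀ z b, 0 < σ2 z b := fun z b => hlo.trans_le (hσ z b).1
  -- A single null set serves all criteria and all levels.
  have key := CATE.ae_biasDominates hX hD hindep hident hdens (fun z b => (hσ z b).2) hS hGlow hG
    hoverlap hC
  refine ⟨?_, fun α h0 h1 => ?_, fun α β h0 h1 h2 => ?_⟩
  · filter_upwards [key] with ω h using (h.worstMSE hC.le :)
  · filter_upwards [key] with ω h using (h.flciLength hC.le hpos h0 h1 :)
  · filter_upwards [key] with ω h using (h.worstExcess hC.le hpos h0 h1 h2 :)
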